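/- Let $d\in\{2,3\}$, let $K\subset\mathbb{R}^d$ be a compact convex reference cell with nonempty interior (e.g. a simplex or a cube), and fix two Lagrange elements on $K$, one for the director and one for the multiplier: each consists of finitely many nodes in $K$ and polynomial shape functions that are dual to the nodal values and whose span contains the constants. Let $0<\alpha\le 1\le\beta$ and $L\in\mathbb{R}$. Then there is a constant $C>0$, depending only on these data, such that the following holds. Let $\Omega\subset\mathbb{R}^d$ be a bounded open set that is the interior of its closure (e.g. a bounded Lipschitz domain), and let $\mathbf n_k:\Omega\to\mathbb{R}^3$ be weakly differentiable with $\alpha\le|\mathbf n_k|^2\le\beta$ and $|\nabla\mathbf n_k|\le L$ a.e. in $\Omega$. Consider a mesh of $\Omega$, i.e. finitely many affine images of $K$ with pairwise disjoint interiors whose union is $\overline\Omega$, and let $h$ be the largest diameter of a cell. Let $Q_h\subset L^2(\Omega)$ be the finite element space of the multiplier element, spanned by its nodal basis functions $\chi_1,\dots,\chi_m$ (one per global node, where nodes of different cells that coincide as points are identified; the restriction of a basis function to a cell is the transported shape function of its node, or $0$ if the node does not belong to the cell). Let $V_h=\mathrm{span}\{\phi_1,\dots,\phi_N\}$, where $\phi_1,\dots,\phi_N$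 are the scalar nodal basis functions of the director element at the nodes inside $\Omega$, multiplied by the unit vectors of $\mathbb{R}^3$; assume that $V_h$ is conforming, $V_h\subset H^1_0(\Omega;\mathbb{R}^3)$, in the sense that its functions are continuous on $\overline\Omega$ and vanish on $\partial\Omega$. Define the matrices $$(A_*)_{ij}=4\int_\Omega(\mathbf n_k\cdot\phi_j)(\mathbf n_k\cdot\phi_i)\,dx,\qquad B_{ji}=\int_\Omega \chi_j\,(2\,\mathbf n_k\cdot\phi_i)\,dx,\qquad (M_\lambda)_{ij}=\int_\Omega\chi_i\chi_j\,dx .$$ Then for every $\delta\mathbf n_h=\sum_i U_i\phi_i\in V_h$ (in particular for the director component of a solution $(\delta\mathbf n_h,\delta\lambda_h)\in V_h\times Q_h$ of the augmented discrete linearized system at $(\mathbf n_k,\lambda_k)$) $$\left\|\left(A_*-B^\top M_\lambda^{-1}B\right)U\right\|_{\mathbb{R}^N}\le C\,h^{1+\frac d2}\,\|\delta\mathbf n_h\|_1,$$ where $\|\cdot\|_{\mathbb{R}^N}$ is the Euclidean norm and $\|v\|_1^2=\|v\|_0^2+\|\nabla v\|_0^2$ is the squared $H^1(\Omega)$ norm.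 Consequently, along any sequence of such meshes of $\Omega$ with $h\to0$ and any $\delta\mathbf n_h\in V_h$ with $\|\delta\mathbf n_h\|_1$ bounded, $\|(A_*-B^\top M_\lambda^{-1}B)U\|_{\mathbb{R}^N}\to0$. -/

import Mathlib

open MeasureTheory Filter Topology
open scoped ENNReal NNReal ContDiff Matrix

noncomputable section

namespace OseenFrank

/-- Physical space `ℝᵈ` with the Euclidean norm. -/
abbrev Pt (d : ℕ) := EuclideanSpace ℝ (Fin d)

/-- Directors take values in `ℝ³`, also when `d = 2`. -/
abbrev Dir := EuclideanSpace ℝ (Fin 3)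

/-- A Lagrange finite element on the reference cell `K`: nodes in `K` and polynomial shape
functions dual to the nodal values, whose span `P̂` contains the constants
(equivalently, the shape functions sum to one). Elements such as `ℙ_k` on a simplex, `ℚ_k` on a
cube or bubble-enriched elements are of this form; discontinuous elements are obtained by
placing the nodes in the interior of `K`. -/
structure LagrangeElement {d : ℕ} (K : Set (Pt d)) where
  /-- number of nodes -/
  num : ℕ
  /-- the nodes -/
  node : Fin num → Pt d
  node_mem : ∀ a, node a ∈ K
  /-- the shape functions -/
  shape : Fin num → MvPolynomial (Fin d) ℝ
  shape_node : ∀ a b, MvPolynomial.eval (fun l => node b l) (shape a) = if a = b then 1 else 0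
  sum_shape : ∑ a, shape a = 1

/-- A non-overlapping mesh of `Ω` whose cells are affine images of the reference cell `K`. -/
structure AffineMesh {d : ℕ} (K Ω : Set (Pt d)) where
  /-- number of cells -/
  num : ℕ
  /-- the affine bijections from the reference cell onto the cells -/
  map : Fin num → (Pt d ≃ᵃ[ℝ] Pt d)
  cover : ⋃ i, map i '' K = closure Ω
  disjoint : ∀ i j, i ≠ j → Disjoint (interior (map i '' K)) (interior (map j '' K))

namespace AffineMesh

variable {d : ℕ} {K Ω : Set (Pt d)}

/-- The mesh size `h`: the largest diameter of a cell. -/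
def size (T : AffineMesh K Ω) : ℝ := ⨆ i, Metric.diam (T.map i '' K)

open Classical in
/-- The global nodes of a Lagrange element on the mesh. Local nodes of different cells that
coincide as points are identified. -/
def nodes (T : AffineMesh K Ω) (R : LagrangeElement K) : Finset (Pt d) :=
  Finset.univ.image fun p : Fin T.num × Fin R.num => T.map p.1 (R.node p.2)

open Classical in
/-- The global nodes that do not lie on the boundary of `Ω`. -/
def interiorNodes (T : AffineMesh K Ω) (R : LagrangeElement K) : Finset (Pt d) :=
  (T.nodes R).filter (· ∈ Ω)

open Classical in
/-- The restriction to the `i`-th cell of the global basis function attached to the node `x`: the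
transported shape function of `x` if `x` is a node of that cell, and zero otherwise. -/
def localBasisFn (T : AffineMesh K Ω) (R : LagrangeElement K) (x : Pt d) (i : Fin T.num)
    (y : Pt d) : ℝ :=
  ∑ a, if T.map i (R.node a) = x then
    MvPolynomial.eval (fun l => (T.map i).symm y l) (R.shape a) else 0

open Classical in
/-- The global nodal basis function attached to the node `x`. On points shared by several cells
the value is taken from one of them; these points form a null set, and the choice does not matter
when the basis function is continuous. -/
def basisFn (T : AffineMesh K Ω) (R : LagrangeElement K) (x : Pt d) (y : Pt d) : ℝ :=
  if h : ∃ i, y ∈ T.map i '' K then T.localBasisFn R x h.choose y else 0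

/-- Conformity of the director space, `V_h ⊂ H¹₀`: the nodal basis functions of the
nodes inside `Ω` are continuous on `closure Ω` and vanish on the boundary. -/
def IsConforming (T : AffineMesh K Ω) (R : LagrangeElement K) : Prop :=
  ∀ x ∈ T.interiorNodes R, ContinuousOn (T.basisFn R x) (closure Ω) ∧
    ∀ y ∈ frontier Ω, T.basisFn R x y = 0

/-- Degrees of freedom of the director space `V_h`: one for each interior node and each of the
three components. -/
abbrev DirDof (T : AffineMesh K Ω) (R : LagrangeElement K) := ↥(T.interiorNodes R) × Fin 3

/-- Degrees of freedom of the multiplier space `Q_h`: one for each node. -/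
abbrev MulDof (T : AffineMesh K Ω) (R : LagrangeElement K) := ↥(T.nodes R)

/-- The basis functions of `V_h`. -/
def dirBasis (T : AffineMesh K Ω) (R : LagrangeElement K) (k : T.DirDof R) (y : Pt d) : Dir :=
  EuclideanSpace.single k.2 (T.basisFn R k.1 y)

/-- The basis functions of `Q_h`. -/
def mulBasis (T : AffineMesh K Ω) (R : LagrangeElement K) (k : T.MulDof R) (y : Pt d) : ℝ :=
  T.basisFn R k y

/-- The function in `V_h` with coefficient vector `U`. -/
def dirFun (T : AffineMesh K Ω) (R : LagrangeElement K) (U : T.DirDof R → ℝ) (y : Pt d) : Dir :=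
  ∑ k, U k • T.dirBasis R k y

/-- The augmentation matrix `A_*`: the assembly of `4 ⟨n·u, n·v⟩₀`. -/
def augMatrix (T : AffineMesh K Ω) (R : LagrangeElement K) (n : Pt d → Dir) :
    Matrix (T.DirDof R) (T.DirDof R) ℝ :=
  Matrix.of fun k l =>
    4 * ∫ y in Ω, inner ℝ (n y) (T.dirBasis R l y) * inner ℝ (n y) (T.dirBasis R k y)

/-- The constraint matrix `B`: the assembly of `b(v, p) = ⟨p, 2 n·v⟩₀`. -/
def constraintMatrix (T : AffineMesh K Ω) (RV RQ : LagrangeElement K) (n : Pt d → Dir) :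
    Matrix (T.MulDof RQ) (T.DirDof RV) ℝ :=
  Matrix.of fun j k => ∫ y in Ω, T.mulBasis RQ j y * (2 * inner ℝ (n y) (T.dirBasis RV k y))

/-- The mass matrix `M_λ` of the multiplier space. -/
def massMatrix (T : AffineMesh K Ω) (R : LagrangeElement K) :
    Matrix (T.MulDof R) (T.MulDof R) ℝ :=
  Matrix.of fun i j => ∫ y in Ω, T.mulBasis R i y * T.mulBasis R j y

open Classical in
/-- The difference `A_* - Bᵀ M_λ⁻¹ B`. -/
def defectMatrix (T : AffineMesh K Ω) (RV RQ : LagrangeElement K) (n : Pt d → Dir) :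
    Matrix (T.DirDof RV) (T.DirDof RV) ℝ :=
  T.augMatrix RV n -
    (T.constraintMatrix RV RQ n)ᵀ * (T.massMatrix RQ)⁻¹ * T.constraintMatrix RV RQ n

end AffineMesh

/-- `G` is the weak gradient of the vector field `u` on `Ω`: `G (c, l)` is the weak partial
derivative `∂_l u_c`. The norm of `G x` is the Frobenius norm. -/
structure IsWeakGradient {d : ℕ} (Ω : Set (Pt d)) (u : Pt d → Dir)
    (G : Pt d → EuclideanSpace ℝ (Fin 3 × Fin d)) : Prop where
  locallyIntegrable : LocallyIntegrableOn u Ω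
  locallyIntegrable_grad : LocallyIntegrableOn G Ω
  integral_eq : ∀ φ : Pt d → ℝ, ContDiff ℝ ∞ φ → HasCompactSupport φ → tsupport φ ⊆ Ω →
    ∀ (c : Fin 3) (l : Fin d),
      ∫ x in Ω, u x c * fderiv ℝ φ x (EuclideanSpace.single l 1) = -∫ x in Ω, G x (c, l) * φ x

/-- The norm `‖u‖₁ = (‖u‖₀² + ‖∇u‖₀²)^{1/2}` of `H¹(Ω; ℝ³)`; it is `∞` if `u` has no
weak gradient. Weak gradients are unique almost everywhere, so the infimum is over one value. -/
def h1Norm {d : ℕ} (Ω : Set (Pt d)) (u : Pt d → Dir) : ℝ≥0∞ :=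
  ⨅ (G : Pt d → EuclideanSpace ℝ (Fin 3 × Fin d)) (_ : IsWeakGradient Ω u G),
    ((∫⁻ x in Ω, ‖u x‖ₑ ^ 2) + ∫⁻ x in Ω, ‖G x‖ₑ ^ 2) ^ (1 / 2 : ℝ)

end OseenFrank

end

/-!
The defect is four times a Schur complement of `L²` Gram matrices, so `(A_* - Bᵀ M_λ⁻¹ B) U` lists
four times the `L²` inner products of the functions `n · φᵢ` with the residual of the orthogonal
projection of `n · v` onto `Q_h`, where `v = ∑ Uᵢ φᵢ`. Two facts give the powers of `h`. Each `φᵢ`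
lives on a ball of radius `h` and boundedly many of them overlap in the `ℓ¹` sense
`∑ |φᵢ| ≤ S`, which costs a factor `h ^ (d / 2)`. The residual is at most the error of the Lagrange
interpolation of `n · v`: since the shape functions span the constants, on a cell it is bounded by
the oscillation of `n · v`, which is of order `h ‖v‖₁` because `n` has a representative that is
`L`-Lipschitz along segments in `Ω` (mollify), and `v` is polynomial on each cell, where the
oscillation of a polynomial of bounded degree is controlled by the `L²` norm of its gradient.
-/

noncomputable section

namespace OseenFrank

theorem cauchySeq_of_mem_closure_of_eventually_dist_le {X Y : Type*} [PseudoMetricSpace X]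
    [PseudoMetricSpace Y] {w : ℕ → X → Y} {x : X} {s : Set X} {L : ℝ} (hx : x ∈ closure s)
    (hs : ∀ y ∈ s, CauchySeq fun k => w k y)
    (hL : ∀ᶠ y in 𝓝 x, ∀ᶠ k in atTop, dist (w k x) (w k y) ≤ L * dist x y) :
    CauchySeq fun k => w k x := by
  refine Metric.cauchySeq_iff'.2 fun ε hε => ?_
  have hsmall : ∀ᶠ y in 𝓝 x, L * dist x y < ε / 4 := by
    have : Tendsto (fun y => L * dist x y) (𝓝 x) (𝓝 (L * dist x x)) :=
      Continuous.tendsto (by fun_prop) x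
    rw [dist_self, mul_zero] at this
    exact this.eventually_lt_const (by positivity)
  obtain ⟨y, hys, hyL, hyε⟩ :=
    ((mem_closure_iff_frequently.1 hx).and_eventually (hL.and hsmall)).exists
  obtain ⟨N, hN⟩ := Metric.cauchySeq_iff.1 (hs y hys) (ε / 4) (by positivity)
  obtain ⟨M, hM⟩ := eventually_atTop.1 hyL
  refine ⟨max N M, fun k hk => ?_⟩
  have hyN := hN k (le_of_max_le_left hk) (max N M) (le_max_left N M)
  have hkM := hM k (le_of_max_le_right hk)
  have hmax := hM (max N M) (le_max_right N M)
  rw [dist_comm] at hmax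
  linarith [dist_triangle4 (w k x) (w k y) (w (max N M) y) (w (max N M) x)]

section WeakDerivative

variable {E F : Type*} [NormedAddCommGroup E] [NormedSpace ℝ E]
  [NormedAddCommGroup F] [NormedSpace ℝ F]

theorem fderiv_eq_zero_of_notMem_tsupport {u : E → F} {x : E} (hx : x ∉ tsupport u) :
    fderiv ℝ u x = 0 :=
  image_eq_zero_of_notMem_tsupport fun h => hx (tsupport_fderiv_subset ℝ h)

variable [MeasurableSpace E] {μ : Measure E} {Ω D : Set E} {u v : E → F} {G G' : E → E →L[ℝ] F}
  {L : ℝ}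

/-- `G` is the distributional derivative of `u` on `Ω` with respect to `μ`. No integrability is
built in: it is a hypothesis of the lemmas that need it. -/
def HasWeakFDeriv (μ : Measure E) (Ω : Set E) (u : E → F) (G : E → E →L[ℝ] F) : Prop :=
  ∀ φ : E → ℝ, ContDiff ℝ ∞ φ → HasCompactSupport φ → tsupport φ ⊆ Ω → ∀ w : E,
    ∫ x in Ω, fderiv ℝ φ x w • u x ∂μ = -∫ x in Ω, φ x • G x w ∂μ

theorem HasWeakFDeriv.mono (h : HasWeakFDeriv μ Ω u G) (hD : D ⊆ Ω) :
    HasWeakFDeriv μ D u G := by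
  intro φ hφ hφc hφD w
  have key := h φ hφ hφc (hφD.trans hD) w
  have restrict_eq : ∀ f : E → F, (∀ x ∉ tsupport φ, f x = 0) →
      ∫ x in Ω, f x ∂μ = ∫ x in D, f x ∂μ := fun f hf => by
    rw [setIntegral_eq_integral_of_forall_compl_eq_zero
        fun x hx => hf x fun h => hx (hD (hφD h)),
      setIntegral_eq_integral_of_forall_compl_eq_zero fun x hx => hf x fun h => hx (hφD h)]
  rwa [restrict_eq _ fun x hx => by simp [fderiv_eq_zero_of_notMem_tsupport hx],
    restrict_eq _ fun x hx => by simp [image_eq_zero_of_notMem_tsupport hx]] at key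

theorem HasWeakFDeriv.congr (h : HasWeakFDeriv μ Ω u G) (hΩ : MeasurableSet Ω)
    (huv : Set.EqOn u v Ω) : HasWeakFDeriv μ Ω v G := by
  intro φ hφ hφc hφΩ w
  rw [← h φ hφ hφc hφΩ w]
  exact setIntegral_congr_fun hΩ fun x hx => congrArg (fderiv ℝ φ x w • ·) (huv hx).symm

theorem locallyIntegrableOn_apply (hG : LocallyIntegrableOn G Ω μ) (w : E) :
    LocallyIntegrableOn (fun x => G x w) Ω μ := fun x hx => by
  obtain ⟨s, hs, hi⟩ := hG x hx
  exact ⟨s, hs, (ContinuousLinearMap.apply ℝ F w).integrable_comp hi⟩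

variable [BorelSpace E]

omit [NormedSpace ℝ E] in
theorem integrableOn_smul_of_tsupport_subset (hu : LocallyIntegrableOn u Ω μ) {φ : E → ℝ}
    (hφ : Continuous φ) (hφc : HasCompactSupport φ) (hφΩ : tsupport φ ⊆ Ω) :
    IntegrableOn (fun x => φ x • u x) Ω μ := by
  refine Integrable.integrableOn ?_
  rw [← integrableOn_iff_integrable_of_support_subset (s := tsupport φ)
    fun x hx => subset_tsupport φ (left_ne_zero_of_smul hx)]
  exact (hu.integrableOn_compact_subset hφΩ hφc).continuousOn_smul hφ.continuousOn hφc

theorem hasWeakFDeriv_of_basis {ι : Type*} (b : Module.Basis ι ℝ E)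
    (hu : LocallyIntegrableOn u Ω μ) (hG : LocallyIntegrableOn G Ω μ)
    (h : ∀ φ : E → ℝ, ContDiff ℝ ∞ φ → HasCompactSupport φ → tsupport φ ⊆ Ω → ∀ i,
      ∫ x in Ω, fderiv ℝ φ x (b i) • u x ∂μ = -∫ x in Ω, φ x • G x (b i) ∂μ) :
    HasWeakFDeriv μ Ω u G := by
  intro φ hφ hφc hφΩ w
  have lhs_int (w : E) : IntegrableOn (fun x => fderiv ℝ φ x w • u x) Ω μ :=
    integrableOn_smul_of_tsupport_subset hu
      ((hφ.continuous_fderiv (by simp)).clm_apply continuous_const) (hφc.fderiv_apply ℝ w)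
      ((tsupport_fderiv_apply_subset ℝ w).trans hφΩ)
  have rhs_int (w : E) : IntegrableOn (fun x => φ x • G x w) Ω μ :=
    integrableOn_smul_of_tsupport_subset (locallyIntegrableOn_apply hG w) hφ.continuous hφc hφΩ
  induction b.mem_span w using Submodule.span_induction with
  | mem w hw =>
    obtain ⟨i, rfl⟩ := hw
    exact h φ hφ hφc hφΩ i
  | zero => simp
  | add w w' _ _ hw hw' =>
    simp only [map_add, add_smul, smul_add]
    rw [integral_add (lhs_int w) (lhs_int w'), integral_add (rhs_int w) (rhs_int w'), hw, hw',
      neg_add]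
  | smul c w _ hw =>
    simp only [map_smul, smul_assoc, smul_comm _ c]
    rw [integral_smul, integral_smul, hw, smul_neg]

variable [FiniteDimensional ℝ E]

theorem hasWeakFDeriv_fderiv [μ.IsAddHaarMeasure] (hu : ContDiff ℝ 1 u) :
    HasWeakFDeriv μ Ω u (fderiv ℝ u) := by
  intro φ hφ hφc hφΩ w
  have hφ' : Continuous fun x => fderiv ℝ φ x w :=
    (hφ.continuous_fderiv (by simp)).clm_apply continuous_const
  have hu' : Continuous fun x => fderiv ℝ u x w :=
    (hu.continuous_fderiv (by simp)).clm_apply continuous_const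
  have hφ'c : HasCompactSupport fun x => fderiv ℝ φ x w := hφc.fderiv_apply ℝ w
  rw [setIntegral_eq_integral_of_forall_compl_eq_zero fun x hx => by
      simp [fderiv_eq_zero_of_notMem_tsupport fun h => hx (hφΩ h)],
    setIntegral_eq_integral_of_forall_compl_eq_zero fun x hx => by
      simp [image_eq_zero_of_notMem_tsupport fun h => hx (hφΩ h)],
    integral_smul_fderiv_eq_neg_fderiv_smul_of_integrable, neg_neg]
  · exact (hφ'.smul hu.continuous).integrable_of_hasCompactSupport hφ'c.smul_right
  · exact (hφ.continuous.smul hu').integrable_of_hasCompactSupport hφc.smul_right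
  · exact (hφ.continuous.smul hu.continuous).integrable_of_hasCompactSupport hφc.smul_right
  · exact fun x _ => hφ.differentiable (by simp) x
  · exact fun x _ => hu.differentiable (by simp) x

open scoped Convolution

theorem HasWeakFDeriv.convolution_fderiv_apply [μ.IsAddHaarMeasure]
    (hG : HasWeakFDeriv μ Ω u G) (hΩ : MeasurableSet Ω) (hu : IntegrableOn u Ω μ) {η : E → ℝ}
    (hη : ContDiff ℝ ∞ η) (hηc : HasCompactSupport η) {x : E}
    (hx : tsupport (fun t => η (x - t)) ⊆ Ω) (w : E) :
    (fderiv ℝ η ⋆[(ContinuousLinearMap.lsmul ℝ ℝ).precompL E, μ] Ω.indicator u) x w =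
      ∫ t in Ω, η (x - t) • G t w ∂μ := by
  have hui : LocallyIntegrable (Ω.indicator u) μ := (hu.integrable_indicator hΩ).locallyIntegrable
  have fderiv_reflect (t : E) : fderiv ℝ (fun t => η (x - t)) t w = -fderiv ℝ η (x - t) w := by
    have := (hη.differentiable (by simp) (x - t)).hasFDerivAt.comp t
      ((hasFDerivAt_id t).const_sub x)
    simpa [Function.comp_def] using congrArg (· w) this.fderiv
  have hconv := (hηc.fderiv ℝ).convolutionExists_left ((ContinuousLinearMap.lsmul ℝ ℝ).precompL E)
    (hη.continuous_fderiv (by simp)) hui x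
  have htest := hG (fun t => η (x - t)) (hη.comp (contDiff_const.sub contDiff_id))
    (hηc.comp_homeomorph (Homeomorph.subLeft x)) hx w
  rw [convolution_def, ContinuousLinearMap.integral_apply hconv.integrable,
    ← integral_sub_left_eq_self _ μ x, ← neg_eq_iff_eq_neg.2 htest,
    ← integral_neg, ← integral_indicator hΩ]
  refine integral_congr_ae (Eventually.of_forall fun t => ?_)
  by_cases ht : t ∈ Ω <;> simp [ht, fderiv_reflect, ContinuousLinearMap.precompL_apply]

theorem HasWeakFDeriv.exists_hasFDerivAt_mollification [μ.IsAddHaarMeasure]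
    (hG : HasWeakFDeriv μ Ω u G) (hΩ : MeasurableSet Ω) (hu : IntegrableOn u Ω μ)
    (hL : 0 ≤ L) (hGL : ∀ᵐ x ∂μ.restrict Ω, ‖G x‖ ≤ L) (φ : ContDiffBump (0 : E)) {x : E}
    (hx : Metric.closedBall x φ.rOut ⊆ Ω) :
    ∃ A : E →L[ℝ] F, ‖A‖ ≤ L ∧ HasFDerivAt
      (φ.normed μ ⋆[ContinuousLinearMap.lsmul ℝ ℝ, μ] Ω.indicator u) A x := by
  have hη : ContDiff ℝ ∞ (φ.normed μ) := φ.contDiff_normed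
  have hηc : HasCompactSupport (φ.normed μ) := φ.hasCompactSupport_normed
  refine ⟨_, ContinuousLinearMap.opNorm_le_bound _ hL fun w => ?_,
    hηc.hasFDerivAt_convolution_left _ (hη.of_le (by simp))
      (hu.integrable_indicator hΩ).locallyIntegrable x⟩
  have hsupp : tsupport (fun t => φ.normed μ (x - t)) ⊆ Metric.closedBall x φ.rOut := by
    refine closure_minimal (fun t ht => ?_) Metric.isClosed_closedBall
    have hmem : x - t ∈ Function.support (φ.normed μ) := ht
    rw [φ.support_normed_eq, mem_ball_zero_iff, ← dist_eq_norm] at hmem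
    exact Metric.mem_closedBall'.2 hmem.le
  have hint : Integrable (fun t => φ.normed μ (x - t) * (L * ‖w‖)) μ :=
    (φ.integrable_normed.comp_sub_left x).mul_const _
  rw [hG.convolution_fderiv_apply hΩ hu hη hηc (hsupp.trans hx)]
  calc ‖∫ t in Ω, φ.normed μ (x - t) • G t w ∂μ‖
      ≤ ∫ t in Ω, φ.normed μ (x - t) * (L * ‖w‖) ∂μ := by
        refine norm_integral_le_of_norm_le hint.integrableOn ?_
        filter_upwards [hGL] with t ht
        rw [norm_smul, Real.norm_of_nonneg (φ.nonneg_normed _)]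
        exact mul_le_mul_of_nonneg_left ((G t).le_of_opNorm_le ht w) (φ.nonneg_normed _)
    _ ≤ ∫ t, φ.normed μ (x - t) * (L * ‖w‖) ∂μ := setIntegral_le_integral hint
        (Eventually.of_forall fun t => mul_nonneg (φ.nonneg_normed _) (by positivity))
    _ = L * ‖w‖ := by
        rw [integral_mul_const, integral_sub_left_eq_self (φ.normed μ) μ x, φ.integral_normed,
          one_mul]

theorem HasWeakFDeriv.eventually_norm_mollification_sub_le [μ.IsAddHaarMeasure]
    (hG : HasWeakFDeriv μ Ω u G) (hΩ : IsOpen Ω) (hu : IntegrableOn u Ω μ)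
    (hL : 0 ≤ L) (hGL : ∀ᵐ x ∂μ.restrict Ω, ‖G x‖ ≤ L) {ι : Type*} {l : Filter ι}
    {φ : ι → ContDiffBump (0 : E)} (hφ : Tendsto (fun k => (φ k).rOut) l (𝓝 0)) {y z : E}
    (hyz : segment ℝ y z ⊆ Ω) :
    ∀ᶠ k in l, ‖((φ k).normed μ ⋆[ContinuousLinearMap.lsmul ℝ ℝ, μ] Ω.indicator u) y -
      ((φ k).normed μ ⋆[ContinuousLinearMap.lsmul ℝ ℝ, μ] Ω.indicator u) z‖ ≤ L * ‖y - z‖ := by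
  have hcomp : IsCompact (segment ℝ y z) := by
    rw [← convexHull_pair (𝕜 := ℝ)]
    exact (Set.toFinite {y, z}).isCompact_convexHull ℝ
  obtain ⟨ε, hε, hεΩ⟩ := hcomp.exists_cthickening_subset_open hΩ hyz
  filter_upwards [hφ.eventually_lt_const hε] with k hk
  have hder : ∀ x ∈ segment ℝ y z, ∃ A : E →L[ℝ] F, ‖A‖ ≤ L ∧ HasFDerivAt
      ((φ k).normed μ ⋆[ContinuousLinearMap.lsmul ℝ ℝ, μ] Ω.indicator u) A x :=
    fun x hx => hG.exists_hasFDerivAt_mollification hΩ.measurableSet hu hL hGL (φ k)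
      ((Metric.closedBall_subset_closedBall hk.le).trans
        ((Metric.closedBall_subset_cthickening hx ε).trans hεΩ))
  choose! A hAL hA using hder
  exact (convex_segment y z).norm_image_sub_le_of_norm_hasFDerivWithin_le
    (fun x hx => (hA x hx).hasFDerivWithinAt) hAL
    (right_mem_segment ℝ y z) (left_mem_segment ℝ y z)

variable [CompleteSpace F]

theorem HasWeakFDeriv.ae_eq (hG : HasWeakFDeriv μ Ω u G)
    (hG' : HasWeakFDeriv μ Ω u G') (hΩ : IsOpen Ω) (hGi : LocallyIntegrableOn G Ω μ)
    (hGi' : LocallyIntegrableOn G' Ω μ) : G =ᵐ[μ.restrict Ω] G' := by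
  have apply_eq : ∀ w : E, ∀ᵐ x ∂μ, x ∈ Ω → (G x - G' x) w = 0 := fun w => by
    refine hΩ.ae_eq_zero_of_integral_contDiff_smul_eq_zero
      ((locallyIntegrableOn_apply hGi w).sub (locallyIntegrableOn_apply hGi' w))
      fun φ hφ hφc hφΩ => ?_
    have hzero : ∀ x ∉ Ω, φ x = 0 := fun x hx =>
      image_eq_zero_of_notMem_tsupport fun h => hx (hφΩ h)
    rw [← setIntegral_eq_integral_of_forall_compl_eq_zero (s := Ω)
      fun x hx => by simp [hzero x hx]]
    simp only [sub_apply, smul_sub]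
    rw [integral_sub, sub_eq_zero]
    rotate_left
    · exact integrableOn_smul_of_tsupport_subset (locallyIntegrableOn_apply hGi w) hφ.continuous
        hφc hφΩ
    · exact integrableOn_smul_of_tsupport_subset (locallyIntegrableOn_apply hGi' w) hφ.continuous
        hφc hφΩ
    exact neg_injective ((hG φ hφ hφc hφΩ w).symm.trans (hG' φ hφ hφc hφΩ w))
  rw [EventuallyEq, ae_restrict_iff' hΩ.measurableSet]
  let b := Module.finBasis ℝ E
  filter_upwards [eventually_countable_forall.2 fun i => apply_eq (b i)] with x hx hxΩ
  refine ContinuousLinearMap.coe_injective (b.ext fun i => ?_)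
  exact sub_eq_zero.1 (hx i hxΩ)

theorem HasWeakFDeriv.exists_lipschitz_representative [μ.IsAddHaarMeasure]
    (hG : HasWeakFDeriv μ Ω u G) (hΩ : IsOpen Ω) (hu : IntegrableOn u Ω μ)
    (hL : 0 ≤ L) (hGL : ∀ᵐ x ∂μ.restrict Ω, ‖G x‖ ≤ L) :
    ∃ v : E → F, u =ᵐ[μ.restrict Ω] v ∧
      ∀ y z, segment ℝ y z ⊆ Ω → ‖v y - v z‖ ≤ L * ‖y - z‖ := by
  have hr : ∀ k : ℕ, (0 : ℝ) < 1 / (k + 1) := fun k => by positivity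
  let φ : ℕ → ContDiffBump (0 : E) := fun k =>
    { rIn := 1 / (k + 1), rOut := 2 * (1 / (k + 1)), rIn_pos := hr k,
      rIn_lt_rOut := by linarith [hr k] }
  have hφ : Tendsto (fun k => (φ k).rOut) atTop (𝓝 0) := by
    simpa only [mul_zero] using (tendsto_one_div_add_atTop_nhds_zero_nat (𝕜 := ℝ)).const_mul 2
  set w : ℕ → E → F := fun k =>
    (φ k).normed μ ⋆[ContinuousLinearMap.lsmul ℝ ℝ, μ] Ω.indicator u
  have hconv : ∀ᵐ x ∂μ, Tendsto (w · x) atTop (𝓝 (Ω.indicator u x)) :=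
    ContDiffBump.ae_convolution_tendsto_right_of_locallyIntegrable (K := 2) hφ
      (Eventually.of_forall fun _ => le_rfl)
      (hu.integrable_indicator hΩ.measurableSet).locallyIntegrable
  have hlip : ∀ y z, segment ℝ y z ⊆ Ω → ∀ᶠ k in atTop, ‖w k y - w k z‖ ≤ L * ‖y - z‖ :=
    fun y z hyz => hG.eventually_norm_mollification_sub_le hΩ hu hL hGL hφ hyz
  have hlim : ∀ x ∈ Ω, Tendsto (w · x) atTop (𝓝 (limUnder atTop (w · x))) := fun x hx => by
    refine (cauchySeq_of_mem_closure_of_eventually_dist_le (L := L)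
      (s := {x | Tendsto (w · x) atTop (𝓝 (Ω.indicator u x))})
      ((Measure.dense_of_ae hconv).closure_eq ▸ Set.mem_univ x)
      (fun y hy => Tendsto.cauchySeq hy) ?_).tendsto_limUnder
    obtain ⟨r, hr, hrΩ⟩ := Metric.isOpen_iff.1 hΩ x hx
    filter_upwards [Metric.ball_mem_nhds x hr] with y hy
    simpa only [dist_eq_norm] using hlip x y
      (((convex_ball x r).segment_subset (Metric.mem_ball_self hr) hy).trans hrΩ)
  refine ⟨fun x => limUnder atTop (w · x), ?_, fun y z hyz => ?_⟩
  · rw [EventuallyEq, ae_restrict_iff' hΩ.measurableSet]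
    filter_upwards [hconv] with x hx hxΩ
    rw [Set.indicator_of_mem hxΩ] at hx
    exact tendsto_nhds_unique hx (hlim x hxΩ)
  · exact le_of_tendsto ((hlim y (hyz (left_mem_segment ℝ y z))).sub
      (hlim z (hyz (right_mem_segment ℝ y z)))).norm (hlip y z hyz)

end WeakDerivative

section WeakGradient

variable {d : ℕ}

/-- The linear map with a given matrix of partial derivatives; it translates the gradients of
`IsWeakGradient` into Fréchet derivatives. -/
def gradMap : EuclideanSpace ℝ (Fin 3 × Fin d) →L[ℝ] Pt d →L[ℝ] Dir :=
  ∑ p : Fin 3 × Fin d, (EuclideanSpace.proj p).smulRight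
    ((EuclideanSpace.proj p.2).smulRight (EuclideanSpace.single p.1 1))

theorem gradMap_apply (A : EuclideanSpace ℝ (Fin 3 × Fin d)) (w : Pt d) (c : Fin 3) :
    gradMap A w c = ∑ l, A (c, l) * w l := by
  simp [gradMap, Fintype.sum_prod_type, Finset.sum_apply, Pi.single_apply]

theorem norm_gradMap_le (A : EuclideanSpace ℝ (Fin 3 × Fin d)) : ‖gradMap A‖ ≤ ‖A‖ := by
  refine ContinuousLinearMap.opNorm_le_bound _ (norm_nonneg A) fun w => ?_
  rw [← sq_le_sq₀ (norm_nonneg _) (by positivity), mul_pow]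
  simp only [EuclideanSpace.norm_sq_eq, Real.norm_eq_abs, sq_abs, gradMap_apply,
    Fintype.sum_prod_type, Finset.sum_mul (s := (Finset.univ : Finset (Fin 3)))]
  exact Finset.sum_le_sum fun c _ => Finset.sum_mul_sq_le_sq_mul_sq _ _ _

theorem IsWeakGradient.locallyIntegrable_gradMap {Ω : Set (Pt d)} {u : Pt d → Dir}
    {G : Pt d → EuclideanSpace ℝ (Fin 3 × Fin d)} (h : IsWeakGradient Ω u G) :
    LocallyIntegrableOn (fun x => gradMap (G x)) Ω := fun x hx => by
  obtain ⟨s, hs, hi⟩ := h.locallyIntegrable_grad x hx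
  exact ⟨s, hs, gradMap.integrable_comp hi⟩

theorem IsWeakGradient.hasWeakFDeriv {Ω : Set (Pt d)} {u : Pt d → Dir}
    {G : Pt d → EuclideanSpace ℝ (Fin 3 × Fin d)} (h : IsWeakGradient Ω u G) :
    HasWeakFDeriv volume Ω u fun x => gradMap (G x) := by
  have hG := h.locallyIntegrable_gradMap
  refine hasWeakFDeriv_of_basis (EuclideanSpace.basisFun (Fin d) ℝ).toBasis h.locallyIntegrable hG
    fun φ hφ hφc hφΩ l => ?_
  have integral_coord {f : Pt d → Dir} (hf : Integrable f (volume.restrict Ω)) (c : Fin 3) :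
      (∫ x in Ω, f x) c = ∫ x in Ω, f x c :=
    ((EuclideanSpace.proj c : Dir →L[ℝ] ℝ).integral_comp_comm hf).symm
  ext c
  rw [PiLp.neg_apply, integral_coord, integral_coord]
  · simpa [mul_comm, gradMap_apply, Pi.single_apply] using h.integral_eq φ hφ hφc hφΩ c l
  · exact integrableOn_smul_of_tsupport_subset (locallyIntegrableOn_apply hG _) hφ.continuous
      hφc hφΩ
  · exact integrableOn_smul_of_tsupport_subset h.locallyIntegrable
      ((hφ.continuous_fderiv (by simp)).clm_apply continuous_const) (hφc.fderiv_apply ℝ _)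
      ((tsupport_fderiv_apply_subset ℝ _).trans hφΩ)

end WeakGradient

section LeastSquares

variable {ι κ H : Type*} [Fintype κ] [DecidableEq κ] [NormedAddCommGroup H]
  [InnerProductSpace ℝ H]

/-- The Schur complement of `gram b` in the Gram matrix of the two families together. For linearly
independent `b` it is the Gram matrix of the components of `ψ` orthogonal to the span of `b`. -/
def residualGram (b : κ → H) (ψ : ι → H) : Matrix ι ι ℝ :=
  Matrix.gram ℝ ψ - (Matrix.of fun j i => inner ℝ (b j) (ψ i))ᵀ * (Matrix.gram ℝ b)⁻¹ *
    Matrix.of fun j i => inner ℝ (b j) (ψ i)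

variable [Fintype ι] {b : κ → H}

theorem exists_residualGram_mulVec_eq_inner (hb : LinearIndependent ℝ b) (ψ : ι → H)
    (U : ι → ℝ) :
    ∃ p ∈ Submodule.span ℝ (Set.range b),
      (∀ v ∈ Submodule.span ℝ (Set.range b), inner ℝ v (∑ i, U i • ψ i - p) = 0) ∧
      ∀ i, (residualGram b ψ *ᵥ U) i = inner ℝ (ψ i) (∑ i, U i • ψ i - p) := by
  set B : Matrix κ ι ℝ := Matrix.of fun j i => inner ℝ (b j) (ψ i) with hB
  set c : κ → ℝ := (Matrix.gram ℝ b)⁻¹ *ᵥ (B *ᵥ U) with hc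
  have hdet : IsUnit (Matrix.gram ℝ b).det :=
    (Matrix.det_gram_ne_zero_iff_linearIndependent.2 hb).isUnit
  have normal_eq : Matrix.gram ℝ b *ᵥ c = B *ᵥ U := by
    rw [hc, Matrix.mulVec_mulVec, Matrix.mul_nonsing_inv _ hdet, Matrix.one_mulVec]
  have orth (j) : inner ℝ (b j) (∑ i, U i • ψ i - ∑ j, c j • b j) = 0 := by
    have := congrFun normal_eq j
    simp only [Matrix.mulVec, dotProduct, Matrix.gram_apply, hB, Matrix.of_apply] at this
    simp only [inner_sub_right, inner_sum, inner_smul_right, mul_comm (U _), mul_comm (c _), this,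
      sub_self]
  refine ⟨∑ j, c j • b j, Submodule.sum_smul_mem _ _ fun j _ =>
    Submodule.subset_span (Set.mem_range_self j), fun v hv => ?_, fun i => ?_⟩
  · refine Submodule.mem_orthogonal_singleton_iff_inner_left.1 (Submodule.span_le.2 ?_ hv)
    rintro _ ⟨j, rfl⟩
    exact Submodule.mem_orthogonal_singleton_iff_inner_left.2 (orth j)
  · rw [residualGram, Matrix.sub_mulVec, ← Matrix.mulVec_mulVec, ← Matrix.mulVec_mulVec, ← hB, ← hc]
    simp only [Pi.sub_apply, Matrix.mulVec, dotProduct, Matrix.gram_apply, hB, Matrix.of_apply,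
      Matrix.transpose_apply, inner_sub_right, inner_sum, inner_smul_right, mul_comm (U _),
      mul_comm (c _), real_inner_comm]

theorem nnnorm_residualGram_mulVec_sq_le (hb : LinearIndependent ℝ b) {ψ : ι → H} {k : ℝ≥0}
    (hψ : ∀ w : ι → ℝ, ‖∑ i, w i • ψ i‖₊ ^ 2 ≤ k * ‖WithLp.toLp 2 w‖₊ ^ 2) (U : ι → ℝ) {q : H}
    (hq : q ∈ Submodule.span ℝ (Set.range b)) :
    ‖WithLp.toLp 2 (residualGram b ψ *ᵥ U)‖₊ ^ 2 ≤ k * ‖∑ i, U i • ψ i - q‖₊ ^ 2 := by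
  obtain ⟨p, hp, orth, hD⟩ := exists_residualGram_mulVec_eq_inner hb ψ U
  set g := ∑ i, U i • ψ i
  set w := residualGram b ψ *ᵥ U
  have residual_le : ‖g - p‖ ≤ ‖g - q‖ := by
    have pythagoras := norm_add_sq_eq_norm_sq_add_norm_sq_real
      (orth (p - q) (Submodule.sub_mem _ hp hq))
    rw [sub_add_sub_cancel'] at pythagoras
    exact (mul_self_le_mul_self_iff (norm_nonneg _) (norm_nonneg _)).2 (by nlinarith)
  have norm_sq_eq : ‖WithLp.toLp 2 w‖ ^ 2 = inner ℝ (∑ i, w i • ψ i) (g - p) := by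
    simp only [EuclideanSpace.norm_sq_eq, sum_inner, inner_smul_left, ← hD]
    simp [w, sq]
  have key : ‖WithLp.toLp 2 w‖ ^ 2 * ‖WithLp.toLp 2 w‖ ^ 2 ≤
      ‖WithLp.toLp 2 w‖ ^ 2 * (k * ‖g - p‖ ^ 2) := calc
    _ = inner ℝ (∑ i, w i • ψ i) (g - p) ^ 2 := by rw [norm_sq_eq, sq]
    _ ≤ (‖∑ i, w i • ψ i‖ * ‖g - p‖) ^ 2 := by
        refine sq_le_sq' ?_ (real_inner_le_norm _ _)
        exact neg_le_of_abs_le (abs_real_inner_le_norm _ _)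
    _ ≤ k * ‖WithLp.toLp 2 w‖ ^ 2 * ‖g - p‖ ^ 2 := by
        rw [mul_pow]
        gcongr
        exact_mod_cast hψ w
    _ = _ := by ring
  have bound : ‖WithLp.toLp 2 w‖ ^ 2 ≤ k * ‖g - p‖ ^ 2 := by
    rcases (sq_nonneg ‖WithLp.toLp 2 w‖).eq_or_lt with h0 | hpos
    · rw [← h0]
      positivity
    · exact le_of_mul_le_mul_left key hpos
  have : ‖WithLp.toLp 2 w‖ ^ 2 ≤ k * ‖g - q‖ ^ 2 := bound.trans (by gcongr)
  exact_mod_cast this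

end LeastSquares

section FiniteDimensional

variable {V W X F : Type*} [AddCommGroup V] [Module ℝ V] [FiniteDimensional ℝ V]
  [NormedAddCommGroup W] [NormedSpace ℝ W] [NormedAddCommGroup F] [NormedSpace ℝ F]

theorem exists_nnnorm_le_mul_nnnorm_of_ker_le (A : V →ₗ[ℝ] F) (B : V →ₗ[ℝ] W) (h : A.ker ≤ B.ker) :
    ∃ C : ℝ≥0, ∀ c, ‖B c‖₊ ≤ C * ‖A c‖₊ := by
  obtain ⟨s, hs⟩ := A.rangeRestrict.exists_rightInverse_of_surjective A.range_rangeRestrict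
  let B' : A.range →L[ℝ] W := (B ∘ₗ s).toContinuousLinearMap
  refine ⟨‖B'‖₊, fun c => ?_⟩
  have factor : B c = B' (A.rangeRestrict c) := by
    have hker : c - s (A.rangeRestrict c) ∈ A.ker := by
      rw [LinearMap.mem_ker, map_sub, sub_eq_zero]
      exact congrArg Subtype.val (LinearMap.congr_fun hs (A.rangeRestrict c)).symm
    rw [← sub_eq_zero]
    simpa [B'] using h hker
  rw [factor]
  exact B'.le_opNNNorm _

omit [NormedSpace ℝ F] in
theorem eLpNorm_two_sq [MeasurableSpace X] (f : X → F) (ν : Measure X) :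
    eLpNorm f 2 ν ^ 2 = ∫⁻ x, ‖f x‖ₑ ^ 2 ∂ν := by
  simpa using eLpNorm_nnreal_pow_eq_lintegral (f := f) (μ := ν) two_ne_zero

theorem exists_enorm_sq_le_mul_lintegral [MeasurableSpace X] {ν : Measure X} (A : V →ₗ[ℝ] X → F)
    (hA : ∀ c, MemLp (A c) 2 ν) (B : V →ₗ[ℝ] W) (h : ∀ c, A c =ᵐ[ν] 0 → B c = 0) :
    ∃ C : ℝ≥0, ∀ c, ‖B c‖ₑ ^ 2 ≤ C * ∫⁻ x, ‖A c x‖ₑ ^ 2 ∂ν := by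
  let A' : V →ₗ[ℝ] Lp F 2 ν :=
    { toFun c := (hA c).toLp (A c)
      map_add' c c' := by
        rw [← MemLp.toLp_add]
        exact MemLp.toLp_congr _ _ (by simp)
      map_smul' r c := by
        rw [RingHom.id_apply, ← MemLp.toLp_const_smul]
        exact MemLp.toLp_congr _ _ (by simp) }
  obtain ⟨C, hC⟩ := exists_nnnorm_le_mul_nnnorm_of_ker_le A' B fun c hc =>
    h c ((hA c).coeFn_toLp.symm.trans ((congrArg (⇑) hc).eventuallyEq.trans (Lp.coeFn_zero F 2 ν)))
  refine ⟨C ^ 2, fun c => ?_⟩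
  have enorm_le : ‖B c‖ₑ ≤ C * ‖A' c‖ₑ := by
    rw [enorm_eq_nnnorm, enorm_eq_nnnorm]
    exact_mod_cast hC c
  calc ‖B c‖ₑ ^ 2 ≤ (C * ‖A' c‖ₑ) ^ 2 := by gcongr
    _ = (C ^ 2 : ℝ≥0) * ∫⁻ x, ‖A c x‖ₑ ^ 2 ∂ν := by
      rw [mul_pow, ENNReal.coe_pow, ← eLpNorm_two_sq, ← Lp.enorm_toLp (hf := hA c)]
      rfl

end FiniteDimensional

theorem memLp_restrict_of_isCompact {X E : Type*} [TopologicalSpace X] [T2Space X]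
    [MeasurableSpace X] [OpensMeasurableSpace X] [NormedAddCommGroup E]
    {ν : Measure X} [IsFiniteMeasureOnCompacts ν] {K : Set X}
    (hK : IsCompact K) {f : X → E} (hf : ContinuousOn f K) {p : ℝ≥0∞} :
    MemLp f p (ν.restrict K) := by
  have : IsFiniteMeasure (ν.restrict K) := ⟨by simpa using hK.measure_lt_top⟩
  obtain ⟨M, hM⟩ := (hK.image_of_continuousOn hf).isBounded.exists_norm_le
  refine MemLp.of_bound (hf.integrableOn_compact hK).aestronglyMeasurable M ?_
  filter_upwards [ae_restrict_mem hK.measurableSet] with x hx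
  exact hM _ (Set.mem_image_of_mem f hx)

theorem subset_closure_interior_of_convex {E : Type*} [NormedAddCommGroup E] [NormedSpace ℝ E]
    {K : Set E} (hKconv : Convex ℝ K) (hKi : (interior K).Nonempty) : K ⊆ closure (interior K) := by
  rw [hKconv.closure_interior_eq_closure_of_nonempty_interior hKi]
  exact subset_closure

namespace LagrangeElement

variable {d : ℕ} {K : Set (Pt d)} (R : LagrangeElement K) {F : Type*} [NormedAddCommGroup F]
  [NormedSpace ℝ F]

/-- The `a`-th shape function as a function on `ℝᵈ`. -/
def shapeFn (a : Fin R.num) (y : Pt d) : ℝ := MvPolynomial.eval (fun l => y l) (R.shape a)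

/-- The function of the vector-valued reference element with prescribed nodal values. -/
def nodalFn : (Fin R.num → F) →ₗ[ℝ] Pt d → F where
  toFun c y := ∑ a, R.shapeFn a y • c a
  map_add' c c' := by ext y; simp [smul_add, Finset.sum_add_distrib]
  map_smul' r c := by ext y; simp [smul_comm _ r, Finset.smul_sum]

theorem nodalFn_apply (c : Fin R.num → F) (y : Pt d) :
    R.nodalFn c y = ∑ a, R.shapeFn a y • c a := rfl

theorem sum_shapeFn (y : Pt d) : ∑ a, R.shapeFn a y = 1 := by
  simpa [shapeFn] using congrArg (MvPolynomial.eval fun l => y l) R.sum_shape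

theorem nonempty_node : Nonempty (Fin R.num) := by
  by_contra h
  rw [not_nonempty_iff] at h
  simpa using R.sum_shapeFn 0

theorem nodalFn_node (c : Fin R.num → F) (b : Fin R.num) : R.nodalFn c (R.node b) = c b := by
  simp [nodalFn_apply, shapeFn, R.shape_node]

theorem nodalFn_const (v : F) (y : Pt d) : R.nodalFn (fun _ => v) y = v := by
  rw [nodalFn_apply, ← Finset.sum_smul, sum_shapeFn, one_smul]

theorem contDiff_shapeFn {m : WithTop ℕ∞} (a : Fin R.num) : ContDiff ℝ m (R.shapeFn a) := by
  unfold shapeFn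
  induction R.shape a using MvPolynomial.induction_on with
  | C r => simpa using contDiff_const
  | add p q hp hq => simpa using hp.add hq
  | mul_X p l hp =>
    simp only [map_mul, MvPolynomial.eval_X]
    exact hp.mul (contDiff_piLp_apply 2)

theorem contDiff_nodalFn {m : WithTop ℕ∞} (c : Fin R.num → F) : ContDiff ℝ m (R.nodalFn c) :=
  ContDiff.sum (s := Finset.univ) fun a _ => (R.contDiff_shapeFn a).smul contDiff_const

theorem exists_sum_abs_shapeFn_le (hK : IsCompact K) :
    ∃ S : ℝ≥0, ∀ y ∈ K, ∑ a, |R.shapeFn a y| ≤ S := by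
  have hcont : Continuous fun y => ∑ a, |R.shapeFn a y| :=
    continuous_finsetSum _ fun a _ => (R.contDiff_shapeFn (m := 0) a).continuous.abs
  obtain ⟨S, hS⟩ := (hK.image hcont).bddAbove
  exact ⟨S.toNNReal, fun y hy => (hS (Set.mem_image_of_mem _ hy)).trans (Real.le_coe_toNNReal S)⟩

theorem norm_nodalFn_le {S : ℝ} {y : Pt d} (hS : ∑ a, |R.shapeFn a y| ≤ S) (c : Fin R.num → F) :
    ‖R.nodalFn c y‖ ≤ S * ‖c‖ := by
  calc ‖R.nodalFn c y‖ ≤ ∑ a, ‖R.shapeFn a y • c a‖ := by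
        rw [nodalFn_apply]
        exact norm_sum_le _ _
    _ ≤ ∑ a, |R.shapeFn a y| * ‖c‖ := Finset.sum_le_sum fun a _ => by
        rw [norm_smul, Real.norm_eq_abs]
        exact mul_le_mul_of_nonneg_left (norm_le_pi_norm c a) (abs_nonneg _)
    _ ≤ S * ‖c‖ := by rw [← Finset.sum_mul]; gcongr

theorem enorm_nodalFn_le {S : ℝ≥0} {y : Pt d} (hS : ∑ a, |R.shapeFn a y| ≤ S)
    (c : Fin R.num → F) : ‖R.nodalFn c y‖ₑ ≤ S * ‖c‖ₑ := by
  have hle : ‖R.nodalFn c y‖₊ ≤ S * ‖c‖₊ := R.norm_nodalFn_le hS c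
  simp only [enorm_eq_nnnorm]
  exact_mod_cast hle

/-- The gradient of `nodalFn`, as a linear function of the nodal values. -/
def nodalGrad : (Fin R.num → F) →ₗ[ℝ] Pt d → Pt d →L[ℝ] F where
  toFun c := fderiv ℝ (R.nodalFn c)
  map_add' c c' := by
    ext1 y
    rw [map_add, Pi.add_apply]
    exact fderiv_add ((R.contDiff_nodalFn (m := 1) c).differentiable one_ne_zero y)
      ((R.contDiff_nodalFn (m := 1) c').differentiable one_ne_zero y)
  map_smul' r c := by
    ext1 y
    rw [map_smul]
    exact fderiv_const_smul ((R.contDiff_nodalFn (m := 1) c).differentiable one_ne_zero y) r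

theorem nodalGrad_apply (c : Fin R.num → F) (y : Pt d) :
    R.nodalGrad c y = fderiv ℝ (R.nodalFn c) y := rfl

theorem hasFDerivAt_nodalFn (c : Fin R.num → F) (y : Pt d) :
    HasFDerivAt (R.nodalFn c) (R.nodalGrad c y) y :=
  ((R.contDiff_nodalFn (m := 1) c).differentiable one_ne_zero y).hasFDerivAt

theorem continuous_nodalGrad (c : Fin R.num → F) : Continuous (R.nodalGrad c) :=
  (R.contDiff_nodalFn (m := 1) c).continuous_fderiv one_ne_zero

section NormEquivalence

variable [FiniteDimensional ℝ F]

theorem exists_enorm_nodalFn_sq_le (hK : IsCompact K) (hKcl : K ⊆ closure (interior K)) :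
    ∃ C : ℝ≥0, ∀ (c : Fin R.num → F), ∀ y ∈ K,
      ‖R.nodalFn c y‖ₑ ^ 2 ≤ C * ∫⁻ x in K, ‖R.nodalFn c x‖ₑ ^ 2 := by
  obtain ⟨S, hS⟩ := R.exists_sum_abs_shapeFn_le hK
  obtain ⟨C, hC⟩ := exists_enorm_sq_le_mul_lintegral (ν := volume.restrict K) (R.nodalFn (F := F))
    (fun c => memLp_restrict_of_isCompact hK
      (R.contDiff_nodalFn (m := 0) c).continuous.continuousOn) LinearMap.id fun c hc => by
      have hzero := Measure.eqOn_of_ae_eq hc (R.contDiff_nodalFn (m := 0) c).continuous.continuousOn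
        continuousOn_const hKcl
      ext1 a
      simpa [nodalFn_node] using hzero (R.node_mem a)
  refine ⟨S ^ 2 * C, fun c y hy => ?_⟩
  calc ‖R.nodalFn c y‖ₑ ^ 2 ≤ (S * ‖c‖ₑ) ^ 2 := by
        gcongr
        exact R.enorm_nodalFn_le (hS y hy) c
    _ ≤ S ^ 2 * (C * ∫⁻ x in K, ‖R.nodalFn c x‖ₑ ^ 2) := by
        rw [mul_pow]
        gcongr
        exact hC c
    _ = _ := by push_cast; rw [mul_assoc]

theorem exists_enorm_nodalFn_sub_sq_le (hK : IsCompact K) (hKconv : Convex ℝ K)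
    (hKi : (interior K).Nonempty) :
    ∃ C : ℝ≥0, ∀ (c : Fin R.num → F), ∀ y ∈ K, ∀ z ∈ K,
      ‖R.nodalFn c y - R.nodalFn c z‖ₑ ^ 2 ≤ C * ∫⁻ x in K, ‖R.nodalGrad c x‖ₑ ^ 2 := by
  have hKcl := subset_closure_interior_of_convex hKconv hKi
  obtain ⟨S, hS⟩ := R.exists_sum_abs_shapeFn_le hK
  obtain ⟨b⟩ := R.nonempty_node
  let osc : (Fin R.num → F) →ₗ[ℝ] Fin R.num → F :=
    LinearMap.id - LinearMap.pi fun _ => LinearMap.proj (R := ℝ) (φ := fun _ => F) b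
  have hosc (c) : osc c = c - fun _ => c b := rfl
  obtain ⟨C, hC⟩ := exists_enorm_sq_le_mul_lintegral (ν := volume.restrict K) (R.nodalGrad (F := F))
    (fun c => memLp_restrict_of_isCompact hK (R.continuous_nodalGrad c).continuousOn) osc
    fun c hc => by
      have hzero := Measure.eqOn_of_ae_eq hc (R.continuous_nodalGrad c).continuousOn
        continuousOn_const hKcl
      ext1 a
      have hconst := hKconv.norm_image_sub_le_of_norm_hasFDerivWithin_le (C := 0)
        (fun x _ => (R.hasFDerivAt_nodalFn c x).hasFDerivWithinAt)
        (fun x hx => by simp [hzero hx]) (R.node_mem b) (R.node_mem a)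
      simpa [hosc, nodalFn_node] using hconst
  refine ⟨(2 * S) ^ 2 * C, fun c y hy z hz => ?_⟩
  have hshift (x) : R.nodalFn c x = R.nodalFn (osc c) x + c b := by
    rw [hosc, map_sub, Pi.sub_apply, nodalFn_const, sub_add_cancel]
  calc ‖R.nodalFn c y - R.nodalFn c z‖ₑ ^ 2
      ≤ (S * ‖osc c‖ₑ + S * ‖osc c‖ₑ) ^ 2 := by
        rw [hshift y, hshift z, add_sub_add_right_eq_sub]
        gcongr
        exact enorm_sub_le.trans (add_le_add (R.enorm_nodalFn_le (hS y hy) _)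
          (R.enorm_nodalFn_le (hS z hz) _))
    _ = (2 * S) ^ 2 * ‖osc c‖ₑ ^ 2 := by ring
    _ ≤ (2 * S) ^ 2 * (C * ∫⁻ x in K, ‖R.nodalGrad c x‖ₑ ^ 2) := by
        gcongr
        exact hC c
    _ = _ := by push_cast; rw [mul_assoc]

end NormEquivalence

end LagrangeElement

namespace AffineMesh

variable {d : ℕ} {K Ω : Set (Pt d)} (T : AffineMesh K Ω)

section Geometry

/-- The `i`-th cell of the mesh. -/
def cell (i : Fin T.num) : Set (Pt d) := T.map i '' K

/-- The linear part of the `i`-th cell map. -/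
def lin (i : Fin T.num) : Pt d →L[ℝ] Pt d := LinearMap.toContinuousLinearMap (T.map i).linear

theorem lin_sub (i : Fin T.num) (x y : Pt d) : T.lin i (x - y) = T.map i x - T.map i y :=
  (T.map i).toAffineMap.linearMap_vsub x y

theorem hasFDerivAt_map (i : Fin T.num) (y : Pt d) : HasFDerivAt (T.map i) (T.lin i) y :=
  ((T.map i).toContinuousAffineEquiv : Pt d →ᴬ[ℝ] Pt d).hasFDerivAt

theorem continuous_map (i : Fin T.num) : Continuous (T.map i) :=
  (T.map i).toContinuousAffineEquiv.continuous

theorem contDiff_map_symm (i : Fin T.num) {m : WithTop ℕ∞} : ContDiff ℝ m (T.map i).symm :=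
  ((T.map i).toContinuousAffineEquiv.symm : Pt d →ᴬ[ℝ] Pt d).contDiff

theorem map_mem_cell (i : Fin T.num) {y : Pt d} (hy : y ∈ K) : T.map i y ∈ T.cell i :=
  Set.mem_image_of_mem _ hy

theorem symm_mem_of_mem_cell {i : Fin T.num} {y : Pt d} (hy : y ∈ T.cell i) :
    (T.map i).symm y ∈ K := by
  obtain ⟨x, hx, rfl⟩ := hy
  simpa using hx

theorem isCompact_cell (hK : IsCompact K) (i : Fin T.num) : IsCompact (T.cell i) :=
  hK.image (T.continuous_map i)

theorem convex_cell (hKconv : Convex ℝ K) (i : Fin T.num) : Convex ℝ (T.cell i) :=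
  hKconv.affine_image (T.map i).toAffineMap

theorem nonempty_interior_cell (hKi : (interior K).Nonempty) (i : Fin T.num) :
    (interior (T.cell i)).Nonempty :=
  ((T.map i).toContinuousAffineEquiv.toHomeomorph.image_interior K).subst
    (motive := Set.Nonempty) (hKi.image _)

theorem cell_subset_closure_interior (hKconv : Convex ℝ K) (hKi : (interior K).Nonempty)
    (i : Fin T.num) : T.cell i ⊆ closure (interior (T.cell i)) :=
  subset_closure_interior_of_convex (T.convex_cell hKconv i) (T.nonempty_interior_cell hKi i)

theorem cell_subset_closure (i : Fin T.num) : T.cell i ⊆ closure Ω := by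
  rw [← T.cover]
  exact Set.subset_iUnion (fun i => T.map i '' K) i

theorem interior_cell_subset (hreg : interior (closure Ω) = Ω) (i : Fin T.num) :
    interior (T.cell i) ⊆ Ω :=
  (interior_mono (T.cell_subset_closure i)).trans hreg.le

include T in
theorem isCompact_closure (hK : IsCompact K) : IsCompact (closure Ω) := by
  rw [← T.cover]
  exact isCompact_iUnion (T.isCompact_cell hK)

include T in
theorem isFiniteMeasure_restrict (hK : IsCompact K) : IsFiniteMeasure (volume.restrict Ω) :=
  ⟨by simpa using (measure_mono subset_closure).trans_lt (T.isCompact_closure hK).measure_lt_top⟩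

theorem eq_of_mem_interior_cell (hKconv : Convex ℝ K) (hKi : (interior K).Nonempty)
    {i j : Fin T.num} {y : Pt d} (hi : y ∈ interior (T.cell i)) (hj : y ∈ T.cell j) : i = j := by
  by_contra hij
  obtain ⟨z, hzi, hzj⟩ :=
    mem_closure_iff.1 (T.cell_subset_closure_interior hKconv hKi j hj) _ isOpen_interior hi
  exact Set.disjoint_left.1 (T.disjoint i j hij) hzi hzj

theorem dist_le_size (hK : IsCompact K) {i : Fin T.num} {x y : Pt d} (hx : x ∈ T.cell i)
    (hy : y ∈ T.cell i) : dist x y ≤ T.size :=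
  (Metric.dist_le_diam_of_mem (T.isCompact_cell hK i).isBounded hx hy).trans
    (le_ciSup (f := fun i => Metric.diam (T.cell i)) (Set.finite_range _).bddAbove i)

theorem size_nonneg : 0 ≤ T.size := Real.iSup_nonneg fun _ => Metric.diam_nonneg

theorem size_pos (hd : 0 < d) (hK : IsCompact K) (hKi : (interior K).Nonempty) (i : Fin T.num) :
    0 < T.size := by
  have : NeZero d := ⟨hd.ne'⟩
  obtain ⟨x, hx, y, hy, hxy⟩ :=
    (infinite_of_mem_nhds _ (mem_interior_iff_mem_nhds.1 hKi.some_mem)).nontrivial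
  exact (dist_pos.2 ((T.map i).injective.ne hxy)).trans_le
    (T.dist_le_size hK (T.map_mem_cell i hx) (T.map_mem_cell i hy))

theorem exists_norm_lin_le (hK : IsCompact K) (hKi : (interior K).Nonempty) :
    ∃ C : ℝ≥0, ∀ (Ω : Set (Pt d)) (T : AffineMesh K Ω) (i : Fin T.num),
      ‖T.lin i‖ ≤ C * T.size := by
  obtain ⟨x, hx⟩ := hKi
  obtain ⟨r, hr, hrK⟩ := Metric.isOpen_iff.1 isOpen_interior x hx
  refine ⟨(r / 2)⁻¹.toNNReal, fun Ω T i => ?_⟩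
  refine ContinuousLinearMap.opNorm_le_of_unit_norm (mul_nonneg NNReal.zero_le_coe T.size_nonneg)
    fun v hv => ?_
  have hy : x + (r / 2) • v ∈ K :=
    interior_subset (hrK (by simp [Metric.mem_ball, norm_smul, hv, abs_of_pos hr, hr]))
  have hdist := T.dist_le_size hK (T.map_mem_cell i hy) (T.map_mem_cell i (interior_subset hx))
  rw [dist_eq_norm, ← lin_sub, add_sub_cancel_left, map_smul, norm_smul, Real.norm_eq_abs,
    abs_of_pos (half_pos hr)] at hdist
  rwa [Real.coe_toNNReal _ (by positivity), ← div_eq_inv_mul, le_div_iff₀' (half_pos hr)]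

end Geometry

section CellMeasure

theorem ae_mem_interior_cell (hKconv : Convex ℝ K) (i : Fin T.num) :
    ∀ᵐ y ∂volume.restrict (T.cell i), y ∈ interior (T.cell i) := by
  have hnull : ∀ᵐ y, y ∉ frontier (T.cell i) :=
    measure_eq_zero_iff_ae_notMem.1 ((T.convex_cell hKconv i).addHaar_frontier volume)
  filter_upwards [ae_restrict_of_ae hnull,
    ae_restrict_mem₀ ((T.convex_cell hKconv i).nullMeasurableSet volume)] with y hy hyc
  by_contra h
  exact hy ⟨subset_closure hyc, h⟩

theorem ae_restrict_cell_of_interior (hKconv : Convex ℝ K) {i : Fin T.num} {p : Pt d → Prop}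
    (h : ∀ᵐ y ∂volume.restrict (interior (T.cell i)), p y) :
    ∀ᵐ y ∂volume.restrict (T.cell i), p y := by
  rw [ae_restrict_iff' isOpen_interior.measurableSet] at h
  filter_upwards [ae_restrict_of_ae h, T.ae_mem_interior_cell hKconv i] with y hp hy
  exact hp hy

theorem restrict_eq_sum_cell (hK : IsCompact K) (hKconv : Convex ℝ K)
    (hKi : (interior K).Nonempty) (hreg : interior (closure Ω) = Ω) :
    (volume.restrict Ω : Measure (Pt d)) = ∑ i, volume.restrict (T.cell i) := by
  have hmeas (i) : MeasurableSet (T.cell i) := (T.isCompact_cell hK i).measurableSet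
  have hΩ : Ω =ᵐ[volume] ⋃ i, T.cell i := by
    have hsub : Ω ⊆ ⋃ i, T.cell i := subset_closure.trans T.cover.ge
    have hmem : ∀ᵐ y ∂volume.restrict (⋃ i, T.cell i), y ∈ Ω := by
      rw [ae_restrict_iUnion_iff]
      exact fun i => (T.ae_mem_interior_cell hKconv i).mono
        fun y hy => T.interior_cell_subset hreg i hy
    rw [ae_restrict_iff' (MeasurableSet.iUnion hmeas)] at hmem
    filter_upwards [hmem] with y hy
    exact propext ⟨fun h => hsub h, fun h => hy h⟩
  rw [Measure.restrict_congr_set hΩ, Measure.restrict_iUnion_ae (fun i j hij => ?_)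
    fun i => (hmeas i).nullMeasurableSet, Measure.sum_fintype]
  refine measure_mono_null (fun y hy => ?_) ((T.convex_cell hKconv i).addHaar_frontier volume)
  exact ⟨subset_closure hy.1, fun h => hij (T.eq_of_mem_interior_cell hKconv hKi h hy.2)⟩

theorem setLIntegral_cell (hK : MeasurableSet K) (i : Fin T.num) (f : Pt d → ℝ≥0∞) :
    ∫⁻ y in T.cell i, f y = ENNReal.ofReal |(T.lin i).det| * ∫⁻ y in K, f (T.map i y) := by
  rw [cell, lintegral_image_eq_lintegral_abs_det_fderiv_mul volume hK
    (fun x _ => (T.hasFDerivAt_map i x).hasFDerivWithinAt) (T.map i).injective.injOn,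
    lintegral_const_mul' _ _ ENNReal.ofReal_ne_top]

theorem volume_cell (hK : MeasurableSet K) (i : Fin T.num) :
    volume (T.cell i) = ENNReal.ofReal |(T.lin i).det| * volume K := by
  simpa using T.setLIntegral_cell hK i 1

theorem volume_cell_mul_setLIntegral (hK : MeasurableSet K) (i : Fin T.num) (f : Pt d → ℝ≥0∞) :
    volume (T.cell i) * ∫⁻ y in K, f y =
      volume K * ∫⁻ y in T.cell i, f ((T.map i).symm y) := by
  rw [T.volume_cell hK, T.setLIntegral_cell hK]
  simp only [AffineEquiv.symm_apply_apply]
  ring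

theorem volume_cell_ne_zero (hKi : (interior K).Nonempty) (i : Fin T.num) :
    volume (T.cell i) ≠ 0 :=
  ((isOpen_interior.measure_pos _ (T.nonempty_interior_cell hKi i)).trans_le
    (measure_mono interior_subset)).ne'

end CellMeasure

end AffineMesh

namespace AffineMesh

variable {d : ℕ} {K Ω : Set (Pt d)} (T : AffineMesh K Ω) (R : LagrangeElement K)
  {s : Finset (Pt d)} {F : Type*} [NormedAddCommGroup F] [NormedSpace ℝ F]

section FiniteElementFunctions

/-- The finite element function with prescribed values `c` at the global nodes in `s` and value
zero at the others. -/
def feFn (c : s → F) (y : Pt d) : F := ∑ x : s, T.basisFn R x y • c x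

open Classical in
/-- The nodal values on the `i`-th cell of `feFn`. -/
def cellCoef (c : s → F) (i : Fin T.num) (a : Fin R.num) : F :=
  if h : T.map i (R.node a) ∈ s then c ⟨_, h⟩ else 0

omit [NormedSpace ℝ F] in
theorem norm_cellCoef_le (c : s → F) (i : Fin T.num) : ‖T.cellCoef R c i‖ ≤ ‖c‖ := by
  refine (pi_norm_le_iff_of_nonneg (norm_nonneg c)).2 fun a => ?_
  rw [cellCoef]
  split_ifs
  · exact norm_le_pi_norm c _
  · simp

/-- The function on the `i`-th cell with prescribed nodal values. -/
def cellFn (i : Fin T.num) (c : Fin R.num → F) (y : Pt d) : F := R.nodalFn c ((T.map i).symm y)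

theorem contDiff_cellFn {m : WithTop ℕ∞} (i : Fin T.num) (c : Fin R.num → F) :
    ContDiff ℝ m (T.cellFn R i c) :=
  (R.contDiff_nodalFn c).comp (T.contDiff_map_symm i)

theorem sum_localBasisFn_smul (c : s → F) (i : Fin T.num) (y : Pt d) :
    ∑ x : s, T.localBasisFn R x i y • c x =
      T.cellFn R i (T.cellCoef R c i) y := by
  classical
  have hnode (a) : T.cellCoef R c i a = ∑ x : s, if T.map i (R.node a) = x then c x else 0 := by
    rw [cellCoef]
    split_ifs with h
    · rw [Fintype.sum_eq_single ⟨_, h⟩ fun x hx => if_neg fun h' => hx (Subtype.ext h'.symm)]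
      simp
    · exact (Finset.sum_eq_zero fun x _ => if_neg fun hx => h (by rw [hx]; exact x.2)).symm
  simp only [cellFn, R.nodalFn_apply, hnode, localBasisFn, Finset.sum_smul, Finset.smul_sum]
  rw [Finset.sum_comm]
  refine Finset.sum_congr rfl fun a _ => Finset.sum_congr rfl fun x _ => ?_
  split_ifs <;> simp [LagrangeElement.shapeFn]

theorem continuous_localBasisFn (x : Pt d) (i : Fin T.num) :
    Continuous (T.localBasisFn R x i) := by
  classical
  refine continuous_finsetSum _ fun a _ => ?_
  split_ifs
  · exact (R.contDiff_shapeFn (m := 0) a).continuous.comp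
      (T.contDiff_map_symm i (m := 0)).continuous
  · exact continuous_const

theorem basisFn_eq_or (y : Pt d) :
    (∃ i, y ∈ T.cell i ∧ ∀ x, T.basisFn R x y = T.localBasisFn R x i y) ∨
      ∀ x, T.basisFn R x y = 0 := by
  by_cases h : ∃ i, y ∈ T.map i '' K
  · exact Or.inl ⟨h.choose, h.choose_spec, fun x => by rw [basisFn, dif_pos h]⟩
  · exact Or.inr fun x => by rw [basisFn, dif_neg h]

theorem basisFn_eq_of_mem_interior (hKconv : Convex ℝ K) (hKi : (interior K).Nonempty)
    (x : Pt d) {i : Fin T.num} {y : Pt d} (hy : y ∈ interior (T.cell i)) :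
    T.basisFn R x y = T.localBasisFn R x i y := by
  have h : ∃ i, y ∈ T.map i '' K := ⟨i, interior_subset hy⟩
  rw [basisFn, dif_pos h, T.eq_of_mem_interior_cell hKconv hKi hy h.choose_spec]

theorem feFn_eq_of_mem_interior (hKconv : Convex ℝ K) (hKi : (interior K).Nonempty)
    (c : s → F) {i : Fin T.num} {y : Pt d} (hy : y ∈ interior (T.cell i)) :
    T.feFn R c y = T.cellFn R i (T.cellCoef R c i) y := by
  rw [← sum_localBasisFn_smul]
  exact Finset.sum_congr rfl fun x _ => by rw [T.basisFn_eq_of_mem_interior R hKconv hKi x hy]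

variable {R} in
theorem IsConforming.feFn_eq_of_mem {T : AffineMesh K Ω} (hT : T.IsConforming R)
    (hKconv : Convex ℝ K) (hKi : (interior K).Nonempty)
    (c : T.interiorNodes R → F) {i : Fin T.num} {y : Pt d} (hy : y ∈ T.cell i) :
    T.feFn R c y = T.cellFn R i (T.cellCoef R c i) y := by
  have hbasis (x : T.interiorNodes R) : T.basisFn R x y = T.localBasisFn R x i y := by
    have heq : Set.EqOn (T.basisFn R x) (T.localBasisFn R x i) (interior (T.cell i)) :=
      fun z hz => T.basisFn_eq_of_mem_interior R hKconv hKi x hz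
    exact heq.of_subset_closure ((hT x x.2).1.mono (T.cell_subset_closure i))
      (T.continuous_localBasisFn R x i).continuousOn interior_subset
      (T.cell_subset_closure_interior hKconv hKi i) hy
  rw [← sum_localBasisFn_smul]
  exact Finset.sum_congr rfl fun x _ => by rw [hbasis x]

variable {R} in
theorem IsConforming.feFn_eq_zero {T : AffineMesh K Ω} (hT : T.IsConforming R)
    (c : T.interiorNodes R → F) {y : Pt d} (hy : y ∈ frontier Ω) : T.feFn R c y = 0 :=
  Finset.sum_eq_zero fun x _ => by rw [(hT x x.2).2 y hy, zero_smul]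

theorem norm_feFn_le {S : ℝ} (hS : ∀ y ∈ K, ∑ a, |R.shapeFn a y| ≤ S) (hS0 : 0 ≤ S)
    (c : s → F) (y : Pt d) : ‖T.feFn R c y‖ ≤ S * ‖c‖ := by
  rcases T.basisFn_eq_or R y with ⟨i, hi, h⟩ | h
  · simp only [feFn, h, sum_localBasisFn_smul, cellFn]
    exact (R.norm_nodalFn_le (hS _ (T.symm_mem_of_mem_cell hi)) _).trans
      (mul_le_mul_of_nonneg_left (T.norm_cellCoef_le R c i) hS0)
  · simpa [feFn, h] using mul_nonneg hS0 (norm_nonneg c)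

theorem sum_abs_basisFn_le {S : ℝ} (hS : ∀ y ∈ K, ∑ a, |R.shapeFn a y| ≤ S) (hS0 : 0 ≤ S)
    (s : Finset (Pt d)) (y : Pt d) : ∑ x : s, |T.basisFn R x y| ≤ S := by
  let sgn (x : s) : ℝ := SignType.sign (T.basisFn R x y)
  have hsgn : ‖sgn‖ ≤ 1 := (pi_norm_le_iff_of_nonneg zero_le_one).2 fun x => by
    cases h : SignType.sign (T.basisFn R x y) <;> simp [sgn, h]
  calc ∑ x : s, |T.basisFn R x y| = T.feFn R sgn y :=
        Finset.sum_congr rfl fun x _ => (self_mul_sign _).symm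
    _ ≤ S * ‖sgn‖ := (le_abs_self _).trans (T.norm_feFn_le R hS hS0 sgn y)
    _ ≤ S := mul_le_of_le_one_right hS0 hsgn

theorem basisFn_eq_zero (hK : IsCompact K) {x y : Pt d} (h : y ∉ Metric.closedBall x T.size) :
    T.basisFn R x y = 0 := by
  classical
  rcases T.basisFn_eq_or R y with ⟨i, hi, h'⟩ | h'
  · rw [h']
    refine Finset.sum_eq_zero fun a _ => if_neg fun hx => h ?_
    exact T.dist_le_size hK hi (hx ▸ T.map_mem_cell i (R.node_mem a))
  · exact h' x

end FiniteElementFunctions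

section Integrability

variable (hK : IsCompact K) (hKconv : Convex ℝ K) (hKi : (interior K).Nonempty)
  (hreg : interior (closure Ω) = Ω)

include hKconv hKi hreg

include hK in
theorem memLp_basisFn (x : Pt d) {p : ℝ≥0∞} : MemLp (T.basisFn R x) p (volume.restrict Ω) := by
  have := T.isFiniteMeasure_restrict hK
  obtain ⟨S, hS⟩ := R.exists_sum_abs_shapeFn_le hK
  refine MemLp.of_bound ?_ S (ae_of_all _ fun y => ?_)
  · rw [T.restrict_eq_sum_cell hK hKconv hKi hreg, ← Measure.sum_fintype]
    refine AEStronglyMeasurable.sum_measure fun i => ?_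
    refine (T.continuous_localBasisFn R x i).aestronglyMeasurable.congr ?_
    filter_upwards [T.ae_mem_interior_cell hKconv i] with y hy
    exact (T.basisFn_eq_of_mem_interior R hKconv hKi x hy).symm
  · simpa using T.sum_abs_basisFn_le R hS S.2 {x} y

theorem eq_zero_of_feFn_ae_eq_zero {c : T.nodes R → F}
    (h : T.feFn R c =ᵐ[volume.restrict Ω] 0) : c = 0 := by
  ext ⟨x, hx⟩
  obtain ⟨⟨i, a⟩, -, rfl⟩ := Finset.mem_image.1 hx
  have hcell : T.cellFn R i (T.cellCoef R c i) =ᵐ[volume.restrict (T.cell i)] fun _ => 0 := by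
    filter_upwards [T.ae_restrict_cell_of_interior hKconv
      (ae_restrict_of_ae_restrict_of_subset (T.interior_cell_subset hreg i) h),
      T.ae_mem_interior_cell hKconv i] with y hy hyi
    rwa [T.feFn_eq_of_mem_interior R hKconv hKi c hyi] at hy
  have hnode := Measure.eqOn_of_ae_eq hcell
    (T.contDiff_cellFn R (m := 0) i _).continuous.continuousOn continuousOn_const
    (T.cell_subset_closure_interior hKconv hKi i) (T.map_mem_cell i (R.node_mem a))
  simpa [cellFn, R.nodalFn_node, cellCoef, hx] using hnode

end Integrability

end AffineMesh

namespace AffineMesh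

variable {d : ℕ} {K : Set (Pt d)} (R : LagrangeElement K)
  {F : Type*} [NormedAddCommGroup F] [NormedSpace ℝ F]

section CellEstimates

variable {Ω : Set (Pt d)} (T : AffineMesh K Ω)

theorem nodalGrad_symm (i : Fin T.num) (c : Fin R.num → F) (y : Pt d) :
    R.nodalGrad c ((T.map i).symm y) = (fderiv ℝ (T.cellFn R i c) y).comp (T.lin i) := by
  have hcomp : R.nodalFn c = T.cellFn R i c ∘ T.map i := by ext; simp [cellFn]
  have hcell := ((T.contDiff_cellFn R (m := 1) i c).differentiable one_ne_zero
    (T.map i ((T.map i).symm y))).hasFDerivAt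
  rw [LagrangeElement.nodalGrad_apply, hcomp, (hcell.comp _ (T.hasFDerivAt_map i _)).fderiv,
    AffineEquiv.apply_symm_apply]

variable [FiniteDimensional ℝ F] (hK : IsCompact K) (hKconv : Convex ℝ K)
  (hKi : (interior K).Nonempty)

include hK hKconv hKi

theorem exists_volume_cell_mul_enorm_cellFn_sq_le :
    ∃ C : ℝ≥0, ∀ (Ω : Set (Pt d)) (T : AffineMesh K Ω) (i : Fin T.num) (c : Fin R.num → F),
      ∀ y ∈ T.cell i,
        volume (T.cell i) * ‖T.cellFn R i c y‖ₑ ^ 2 ≤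
          C * ∫⁻ x in T.cell i, ‖T.cellFn R i c x‖ₑ ^ 2 := by
  obtain ⟨C, hC⟩ := R.exists_enorm_nodalFn_sq_le (F := F) hK
    (subset_closure_interior_of_convex hKconv hKi)
  refine ⟨(volume K).toNNReal * C, fun Ω T i c y hy => ?_⟩
  calc volume (T.cell i) * ‖T.cellFn R i c y‖ₑ ^ 2
      ≤ volume (T.cell i) * (C * ∫⁻ x in K, ‖R.nodalFn c x‖ₑ ^ 2) := by
        gcongr
        exact hC c _ (T.symm_mem_of_mem_cell hy)
    _ = C * (volume K * ∫⁻ x in T.cell i, ‖T.cellFn R i c x‖ₑ ^ 2) := by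
        rw [mul_left_comm, T.volume_cell_mul_setLIntegral hK.measurableSet]
        rfl
    _ = _ := by
        rw [ENNReal.coe_mul, ENNReal.coe_toNNReal hK.measure_ne_top]
        ring

theorem exists_volume_cell_mul_enorm_cellFn_sub_sq_le :
    ∃ C : ℝ≥0, ∀ (Ω : Set (Pt d)) (T : AffineMesh K Ω) (i : Fin T.num) (c : Fin R.num → F),
      ∀ y ∈ T.cell i, ∀ z ∈ T.cell i,
        volume (T.cell i) * ‖T.cellFn R i c y - T.cellFn R i c z‖ₑ ^ 2 ≤
          C * ENNReal.ofReal T.size ^ 2 *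
            ∫⁻ x in T.cell i, ‖fderiv ℝ (T.cellFn R i c) x‖ₑ ^ 2 := by
  obtain ⟨C, hC⟩ := R.exists_enorm_nodalFn_sub_sq_le (F := F) hK hKconv hKi
  obtain ⟨Cl, hCl⟩ := exists_norm_lin_le hK hKi
  refine ⟨(volume K).toNNReal * C * Cl ^ 2, fun Ω T i c y hy z hz => ?_⟩
  have hlin : ‖T.lin i‖ₑ ≤ Cl * ENNReal.ofReal T.size := by
    rw [← ofReal_norm, ← ENNReal.ofReal_coe_nnreal, ← ENNReal.ofReal_mul NNReal.zero_le_coe]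
    exact ENNReal.ofReal_le_ofReal (hCl Ω T i)
  have hgrad (x) : ‖R.nodalGrad c ((T.map i).symm x)‖ₑ ≤
      ‖fderiv ℝ (T.cellFn R i c) x‖ₑ * (Cl * ENNReal.ofReal T.size) := by
    rw [nodalGrad_symm]
    exact (ContinuousLinearMap.opENorm_comp_le _ _).trans (mul_le_mul_right hlin _)
  calc volume (T.cell i) * ‖T.cellFn R i c y - T.cellFn R i c z‖ₑ ^ 2
      ≤ volume (T.cell i) * (C * ∫⁻ x in K, ‖R.nodalGrad c x‖ₑ ^ 2) := by
        gcongr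
        exact hC c _ (T.symm_mem_of_mem_cell hy) _ (T.symm_mem_of_mem_cell hz)
    _ = C * (volume K * ∫⁻ x in T.cell i, ‖R.nodalGrad c ((T.map i).symm x)‖ₑ ^ 2) := by
        rw [mul_left_comm, T.volume_cell_mul_setLIntegral hK.measurableSet]
    _ ≤ C * (volume K * ∫⁻ x in T.cell i, ‖fderiv ℝ (T.cellFn R i c) x‖ₑ ^ 2 *
          (Cl * ENNReal.ofReal T.size) ^ 2) := by
        gcongr with x
        rw [← mul_pow]
        gcongr
        exact hgrad x
    _ = _ := by
        rw [lintegral_mul_const' _ _ (by finiteness), ENNReal.coe_mul, ENNReal.coe_mul,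
          ENNReal.coe_toNNReal hK.measure_ne_top]
        push_cast
        ring

end CellEstimates

section WeakGradientOnCells

variable [FiniteDimensional ℝ F] {R} {Ω : Set (Pt d)} {T : AffineMesh K Ω}

theorem ae_eq_fderiv_cellFn (hKconv : Convex ℝ K) {s : Finset (Pt d)}
    (hKi : (interior K).Nonempty) (hreg : interior (closure Ω) = Ω)
    {c : s → F} {G : Pt d → Pt d →L[ℝ] F}
    (hG : HasWeakFDeriv volume Ω (T.feFn R c) G) (hGi : LocallyIntegrableOn G Ω) (i : Fin T.num) :
    G =ᵐ[volume.restrict (T.cell i)] fderiv ℝ (T.cellFn R i (T.cellCoef R c i)) := by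
  have hcont := T.contDiff_cellFn R (m := 1) i (T.cellCoef R c i)
  have hsub := T.interior_cell_subset hreg i
  have hG' := (hG.mono hsub).congr isOpen_interior.measurableSet
    (v := T.cellFn R i (T.cellCoef R c i))
    fun y hy => T.feFn_eq_of_mem_interior R hKconv hKi c hy
  exact T.ae_restrict_cell_of_interior hKconv <| hG'.ae_eq (hasWeakFDeriv_fderiv hcont)
    isOpen_interior (hGi.mono_set hsub)
    ((hcont.continuous_fderiv one_ne_zero).locallyIntegrable (μ := volume) |>.locallyIntegrableOn _)

end WeakGradientOnCells

end AffineMesh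

theorem ennreal_add_sq_le (a b : ℝ≥0∞) : (a + b) ^ 2 ≤ 2 * (a ^ 2 + b ^ 2) := by
  have h := ENNReal.rpow_add_le_mul_rpow_add_rpow a b one_le_two
  rw [show (2 : ℝ) - 1 = 1 by norm_num, ENNReal.rpow_one] at h
  exact_mod_cast h

namespace AffineMesh

section Interpolant

variable {d : ℕ} {K Ω : Set (Pt d)} (T : AffineMesh K Ω) (R : LagrangeElement K)
  {F : Type*} [NormedAddCommGroup F] [NormedSpace ℝ F]

/-- The Lagrange interpolant of `f` on the mesh. -/
def interpolant (f : Pt d → F) : Pt d → F := T.feFn R fun x : T.nodes R => f x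

theorem map_node_mem_nodes (i : Fin T.num) (a : Fin R.num) : T.map i (R.node a) ∈ T.nodes R :=
  Finset.mem_image_of_mem _ (Finset.mem_univ (i, a))

theorem exists_norm_sub_interpolant_le {S : ℝ} (hS : ∀ y ∈ K, ∑ a, |R.shapeFn a y| ≤ S)
    (hKconv : Convex ℝ K) (hKi : (interior K).Nonempty) (f : Pt d → F) (v : F) {i : Fin T.num}
    {y : Pt d} (hy : y ∈ interior (T.cell i)) :
    ∃ a, ‖v - T.interpolant R f y‖ ≤ S * ‖v - f (T.map i (R.node a))‖ := by
  have hyK := T.symm_mem_of_mem_cell (interior_subset hy)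
  have := R.nonempty_node
  obtain ⟨a, ha⟩ := Finite.exists_max fun a => ‖v - f (T.map i (R.node a))‖
  have hdiff : v - T.interpolant R f y =
      R.nodalFn (fun a => v - f (T.map i (R.node a))) ((T.map i).symm y) := by
    rw [show (fun a => v - f (T.map i (R.node a))) =
      (fun _ => v) - fun a => f (T.map i (R.node a)) from rfl, map_sub, Pi.sub_apply,
      R.nodalFn_const, interpolant, T.feFn_eq_of_mem_interior R hKconv hKi _ hy, cellFn]
    have hcoef : T.cellCoef R (fun x : T.nodes R => f x) i = fun a => f (T.map i (R.node a)) :=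
      funext fun a => dif_pos (T.map_node_mem_nodes R i a)
    rw [hcoef]
  rw [hdiff]
  refine ⟨a, (R.norm_nodalFn_le (hS _ hyK) _).trans ?_⟩
  have hS0 : 0 ≤ S := (Finset.sum_nonneg fun a _ => abs_nonneg _).trans (hS _ hyK)
  gcongr
  exact (pi_norm_le_iff_of_nonneg (norm_nonneg _)).2 ha

end Interpolant

section LocalInterpolationError

variable {d : ℕ} {K Ω : Set (Pt d)} {T : AffineMesh K Ω} {RV RQ : LagrangeElement K}
  {F : Type*} [NormedAddCommGroup F] [InnerProductSpace ℝ F]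

theorem segment_subset_of_mem_interior_cell (hKconv : Convex ℝ K)
    (hreg : interior (closure Ω) = Ω) {i : Fin T.num} {x y : Pt d}
    (hy : y ∈ interior (T.cell i)) (hx : x ∈ T.cell i) (hxΩ : x ∈ Ω) : segment ℝ y x ⊆ Ω := by
  rw [← insert_endpoints_openSegment, Set.insert_subset_iff, Set.insert_subset_iff]
  exact ⟨T.interior_cell_subset hreg i hy, hxΩ,
    ((T.convex_cell hKconv i).openSegment_interior_closure_subset_interior hy
      (subset_closure hx)).trans (T.interior_cell_subset hreg i)⟩

theorem norm_inner_sub_inner_le (hK : IsCompact K) (hKconv : Convex ℝ K)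
    (hreg : interior (closure Ω) = Ω) (hT : T.IsConforming RV) {b L : ℝ≥0} {m : Pt d → F}
    (hm : ∀ y z, segment ℝ y z ⊆ Ω → ‖m y - m z‖ ≤ L * ‖y - z‖) (c : T.interiorNodes RV → F)
    {i : Fin T.num} {x y : Pt d} (hx : x ∈ T.cell i) (hy : y ∈ interior (T.cell i))
    (hb : ‖m y‖ ≤ b) :
    ‖inner ℝ (m y) (T.feFn RV c y) - inner ℝ (m x) (T.feFn RV c x)‖ ≤
      b * ‖T.feFn RV c y - T.feFn RV c x‖ + L * T.size * ‖T.feFn RV c x‖ := by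
  have hmx : ‖m y - m x‖ * ‖T.feFn RV c x‖ ≤ L * T.size * ‖T.feFn RV c x‖ := by
    by_cases hxΩ : x ∈ Ω
    · gcongr
      calc ‖m y - m x‖ ≤ L * ‖y - x‖ :=
            hm y x (segment_subset_of_mem_interior_cell hKconv hreg hy hx hxΩ)
        _ ≤ L * T.size := by
            rw [← dist_eq_norm]
            gcongr
            exact T.dist_le_size hK (interior_subset hy) hx
    · have hfr : x ∈ frontier Ω :=
        ⟨T.cell_subset_closure i hx, fun h => hxΩ (interior_subset h)⟩
      simp [hT.feFn_eq_zero c hfr]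
  calc ‖inner ℝ (m y) (T.feFn RV c y) - inner ℝ (m x) (T.feFn RV c x)‖
      = ‖inner ℝ (m y) (T.feFn RV c y - T.feFn RV c x) +
          inner ℝ (m y - m x) (T.feFn RV c x)‖ := by
        rw [inner_sub_right, inner_sub_left]
        congr 1
        ring
    _ ≤ ‖m y‖ * ‖T.feFn RV c y - T.feFn RV c x‖ + ‖m y - m x‖ * ‖T.feFn RV c x‖ :=
        (norm_add_le _ _).trans (add_le_add (norm_inner_le_norm _ _) (norm_inner_le_norm _ _))
    _ ≤ _ := by gcongr

theorem exists_enorm_inner_sub_interpolant_le (hK : IsCompact K) (hKconv : Convex ℝ K)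
    (hKi : (interior K).Nonempty) (hreg : interior (closure Ω) = Ω) {S : ℝ≥0}
    (hS : ∀ y ∈ K, ∑ a, |RQ.shapeFn a y| ≤ S) (hT : T.IsConforming RV) {b L : ℝ≥0}
    {m : Pt d → F} (hm : ∀ y z, segment ℝ y z ⊆ Ω → ‖m y - m z‖ ≤ L * ‖y - z‖)
    (c : T.interiorNodes RV → F) {i : Fin T.num} {y : Pt d} (hy : y ∈ interior (T.cell i))
    (hb : ‖m y‖ ≤ b) :
    ∃ x ∈ T.cell i, ‖inner ℝ (m y) (T.feFn RV c y) -
        T.interpolant RQ (fun x => inner ℝ (m x) (T.feFn RV c x)) y‖ₑ ≤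
      S * (b * ‖T.feFn RV c y - T.feFn RV c x‖ₑ +
        L * ENNReal.ofReal T.size * ‖T.feFn RV c x‖ₑ) := by
  obtain ⟨a, ha⟩ := T.exists_norm_sub_interpolant_le RQ hS hKconv hKi
    (fun x => inner ℝ (m x) (T.feFn RV c x)) (inner ℝ (m y) (T.feFn RV c y)) hy
  have hx : T.map i (RQ.node a) ∈ T.cell i := T.map_mem_cell i (RQ.node_mem a)
  have h := ENNReal.ofReal_le_ofReal <| ha.trans <| mul_le_mul_of_nonneg_left
    (norm_inner_sub_inner_le hK hKconv hreg hT hm c hx hy hb) NNReal.zero_le_coe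
  have hsize := T.size_nonneg
  rw [ENNReal.ofReal_mul NNReal.zero_le_coe, ENNReal.ofReal_add (by positivity) (by positivity),
    ENNReal.ofReal_mul NNReal.zero_le_coe, ENNReal.ofReal_mul (by positivity),
    ENNReal.ofReal_mul NNReal.zero_le_coe] at h
  simp only [ofReal_norm, ENNReal.ofReal_coe_nnreal] at h
  exact ⟨_, hx, h⟩

variable [FiniteDimensional ℝ F] (RV RQ) (hK : IsCompact K) (hKconv : Convex ℝ K)
  (hKi : (interior K).Nonempty) (b L : ℝ≥0)

include hK hKconv hKi

theorem exists_volume_cell_mul_interpolation_error_sq_le :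
    ∃ C : ℝ≥0, ∀ (Ω : Set (Pt d)) (T : AffineMesh K Ω), interior (closure Ω) = Ω →
      T.IsConforming RV → ∀ m : Pt d → F,
      (∀ y z, segment ℝ y z ⊆ Ω → ‖m y - m z‖ ≤ L * ‖y - z‖) →
      ∀ (c : T.interiorNodes RV → F) (G : Pt d → Pt d →L[ℝ] F),
      HasWeakFDeriv volume Ω (T.feFn RV c) G → LocallyIntegrableOn G Ω →
      ∀ i, ∀ y ∈ interior (T.cell i), ‖m y‖ ≤ b →
        volume (T.cell i) * ‖inner ℝ (m y) (T.feFn RV c y) -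
            T.interpolant RQ (fun x => inner ℝ (m x) (T.feFn RV c x)) y‖ₑ ^ 2 ≤
          C * ENNReal.ofReal T.size ^ 2 *
            ((∫⁻ x in T.cell i, ‖T.feFn RV c x‖ₑ ^ 2) + ∫⁻ x in T.cell i, ‖G x‖ₑ ^ 2) := by
  obtain ⟨S, hS⟩ := RQ.exists_sum_abs_shapeFn_le hK
  obtain ⟨C₀, hC₀⟩ := exists_volume_cell_mul_enorm_cellFn_sq_le (F := F) RV hK hKconv hKi
  obtain ⟨C₁, hC₁⟩ := exists_volume_cell_mul_enorm_cellFn_sub_sq_le (F := F) RV hK hKconv hKi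
  refine ⟨2 * S ^ 2 * (L ^ 2 * C₀ + b ^ 2 * C₁), fun Ω T hreg hT m hm c G hG hGi i y hy hb => ?_⟩
  set v := T.feFn RV c
  set h := ENNReal.ofReal T.size
  have hcell : Set.EqOn v (T.cellFn RV i (T.cellCoef RV c i)) (T.cell i) :=
    fun z hz => hT.feFn_eq_of_mem hKconv hKi c hz
  obtain ⟨x, hx, herr⟩ :=
    exists_enorm_inner_sub_interpolant_le hK hKconv hKi hreg hS hT hm c hy hb
  have hval : volume (T.cell i) * ‖v x‖ₑ ^ 2 ≤ C₀ * ∫⁻ z in T.cell i, ‖v z‖ₑ ^ 2 := by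
    rw [hcell hx, setLIntegral_congr_fun (T.isCompact_cell hK i).measurableSet
      fun z hz => by rw [hcell hz]]
    exact hC₀ Ω T i _ x hx
  have hosc : volume (T.cell i) * ‖v y - v x‖ₑ ^ 2 ≤
      C₁ * h ^ 2 * ∫⁻ z in T.cell i, ‖G z‖ₑ ^ 2 := by
    have hy' := interior_subset hy
    rw [hcell hx, hcell hy', lintegral_congr_ae ((T.ae_eq_fderiv_cellFn hKconv hKi hreg hG hGi
      i).mono fun z hz => by rw [hz])]
    exact hC₁ Ω T i _ y hy' x hx
  calc volume (T.cell i) * ‖inner ℝ (m y) (v y) -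
          T.interpolant RQ (fun x => inner ℝ (m x) (v x)) y‖ₑ ^ 2
      ≤ volume (T.cell i) * (S ^ 2 * (2 * ((b * ‖v y - v x‖ₑ) ^ 2 + (L * h * ‖v x‖ₑ) ^ 2))) := by
        gcongr
        refine (pow_le_pow_left' herr 2).trans ?_
        rw [mul_pow]
        gcongr
        exact ennreal_add_sq_le _ _
    _ = 2 * S ^ 2 * (b ^ 2 * (volume (T.cell i) * ‖v y - v x‖ₑ ^ 2) +
          L ^ 2 * h ^ 2 * (volume (T.cell i) * ‖v x‖ₑ ^ 2)) := by ring
    _ ≤ 2 * S ^ 2 * (b ^ 2 * (C₁ * h ^ 2 * ∫⁻ z in T.cell i, ‖G z‖ₑ ^ 2) +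
          L ^ 2 * h ^ 2 * (C₀ * ∫⁻ z in T.cell i, ‖v z‖ₑ ^ 2)) := by gcongr
    _ ≤ 2 * S ^ 2 * (b ^ 2 * (C₁ * h ^ 2 * ∫⁻ z in T.cell i, ‖G z‖ₑ ^ 2) +
          L ^ 2 * h ^ 2 * (C₀ * ∫⁻ z in T.cell i, ‖v z‖ₑ ^ 2)) +
        2 * S ^ 2 * (b ^ 2 * (C₁ * h ^ 2 * ∫⁻ z in T.cell i, ‖v z‖ₑ ^ 2) +
          L ^ 2 * h ^ 2 * (C₀ * ∫⁻ z in T.cell i, ‖G z‖ₑ ^ 2)) := le_self_add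
    _ = _ := by
        push_cast
        ring

end LocalInterpolationError

section GlobalInterpolationError

variable {d : ℕ} {K : Set (Pt d)} (RV RQ : LagrangeElement K)
  {F : Type*} [NormedAddCommGroup F] [InnerProductSpace ℝ F] [FiniteDimensional ℝ F]

theorem exists_lintegral_inner_sub_interpolant_sq_le (hK : IsCompact K) (hKconv : Convex ℝ K)
    (hKi : (interior K).Nonempty) (b L : ℝ≥0) :
    ∃ C : ℝ≥0, ∀ (Ω : Set (Pt d)) (T : AffineMesh K Ω), interior (closure Ω) = Ω →
      T.IsConforming RV → ∀ m : Pt d → F, (∀ᵐ y ∂volume.restrict Ω, ‖m y‖ ≤ b) →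
      (∀ y z, segment ℝ y z ⊆ Ω → ‖m y - m z‖ ≤ L * ‖y - z‖) →
      ∀ (c : T.interiorNodes RV → F) (G : Pt d → Pt d →L[ℝ] F),
      HasWeakFDeriv volume Ω (T.feFn RV c) G → LocallyIntegrableOn G Ω →
        ∫⁻ y in Ω, ‖inner ℝ (m y) (T.feFn RV c y) -
            T.interpolant RQ (fun x => inner ℝ (m x) (T.feFn RV c x)) y‖ₑ ^ 2 ≤
          C * ENNReal.ofReal T.size ^ 2 *
            ((∫⁻ y in Ω, ‖T.feFn RV c y‖ₑ ^ 2) + ∫⁻ y in Ω, ‖G y‖ₑ ^ 2) := by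
  obtain ⟨C, hC⟩ := exists_volume_cell_mul_interpolation_error_sq_le (F := F) RV RQ hK hKconv hKi
    b L
  refine ⟨C, fun Ω T hreg hT m hb hm c G hG hGi => ?_⟩
  simp only [T.restrict_eq_sum_cell hK hKconv hKi hreg, lintegral_finsetSum_measure,
    ← Finset.sum_add_distrib, Finset.mul_sum]
  refine Finset.sum_le_sum fun i _ => ?_
  have hvol : volume (T.cell i) ≠ ⊤ := (T.isCompact_cell hK i).measure_ne_top
  have hae := T.ae_restrict_cell_of_interior hKconv
    (ae_restrict_of_ae_restrict_of_subset (T.interior_cell_subset hreg i) hb)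
  rw [← ENNReal.mul_le_mul_iff_right (T.volume_cell_ne_zero hKi i) hvol,
    ← lintegral_const_mul' _ _ hvol]
  calc _ ≤ ∫⁻ _ in T.cell i, C * ENNReal.ofReal T.size ^ 2 *
          ((∫⁻ x in T.cell i, ‖T.feFn RV c x‖ₑ ^ 2) + ∫⁻ x in T.cell i, ‖G x‖ₑ ^ 2) := by
        refine lintegral_mono_ae ?_
        filter_upwards [T.ae_mem_interior_cell hKconv i, hae] with y hy hby
        exact hC Ω T hreg hT m hm c G hG hGi i y hy hby
    _ = _ := by rw [setLIntegral_const, mul_comm]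

end GlobalInterpolationError

section Stability

variable {d : ℕ} {K Ω : Set (Pt d)} (T : AffineMesh K Ω) {R : LagrangeElement K}
  {s : Finset (Pt d)} {F : Type*} [NormedAddCommGroup F] [NormedSpace ℝ F]

theorem enorm_feFn_sq_le (hK : IsCompact K) {S : ℝ≥0}
    (hS : ∀ y ∈ K, ∑ a, |R.shapeFn a y| ≤ S) (c : s → F) (y : Pt d) :
    ‖T.feFn R c y‖ₑ ^ 2 ≤
      S ^ 2 * ∑ x : s, (Metric.closedBall (x : Pt d) T.size).indicator (fun _ => ‖c x‖ₑ ^ 2) y := by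
  have hsum (t : Finset (Pt d)) : ∑ x : t, ‖T.basisFn R x y‖₊ ≤ S := by
    have h := T.sum_abs_basisFn_le R hS S.2 t y
    simp only [← Real.norm_eq_abs, ← coe_nnnorm] at h
    exact_mod_cast h
  have hbasis (x : Pt d) : ‖T.basisFn R x y‖₊ ≤ S := by simpa using hsum {x}
  have hcs : ‖T.feFn R c y‖₊ ^ 2 ≤ S * ∑ x : s, ‖T.basisFn R x y‖₊ * ‖c x‖₊ ^ 2 := calc
    ‖T.feFn R c y‖₊ ^ 2 ≤ (∑ x : s, ‖T.basisFn R x y‖₊ * ‖c x‖₊) ^ 2 := by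
        gcongr
        exact (nnnorm_sum_le _ _).trans_eq (by simp only [nnnorm_smul])
    _ ≤ (∑ x : s, ‖T.basisFn R x y‖₊) * ∑ x : s, ‖T.basisFn R x y‖₊ * ‖c x‖₊ ^ 2 :=
        Finset.sum_sq_le_sum_mul_sum_of_sq_le_mul _ (fun _ _ => zero_le) (fun _ _ => zero_le)
          fun _ _ => by rw [mul_pow, pow_two ‖T.basisFn R _ y‖₊, mul_assoc]
    _ ≤ _ := by gcongr; exact hsum s
  calc ‖T.feFn R c y‖ₑ ^ 2 ≤ S * ∑ x : s, ‖T.basisFn R x y‖ₑ * ‖c x‖ₑ ^ 2 := by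
        simp only [enorm_eq_nnnorm]
        exact_mod_cast hcs
    _ ≤ S * ∑ x : s, S * (Metric.closedBall (x : Pt d) T.size).indicator
          (fun _ => ‖c x‖ₑ ^ 2) y := by
        refine mul_le_mul_right (Finset.sum_le_sum fun x _ => ?_) _
        by_cases hy : y ∈ Metric.closedBall (x : Pt d) T.size
        · rw [Set.indicator_of_mem hy]
          gcongr
          exact_mod_cast hbasis x
        · rw [T.basisFn_eq_zero R hK hy]
          simp
    _ = _ := by rw [← Finset.mul_sum, ← mul_assoc, pow_two]

theorem lintegral_enorm_feFn_sq_le (hK : IsCompact K) {S : ℝ≥0}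
    (hS : ∀ y ∈ K, ∑ a, |R.shapeFn a y| ≤ S) (c : s → F) :
    ∫⁻ y in Ω, ‖T.feFn R c y‖ₑ ^ 2 ≤
      S ^ 2 * volume (Metric.closedBall (0 : Pt d) T.size) * ∑ x, ‖c x‖ₑ ^ 2 := calc
  ∫⁻ y in Ω, ‖T.feFn R c y‖ₑ ^ 2 ≤ ∫⁻ y, S ^ 2 * ∑ x : s,
      (Metric.closedBall (x : Pt d) T.size).indicator (fun _ => ‖c x‖ₑ ^ 2) y :=
    (lintegral_mono fun y => T.enorm_feFn_sq_le hK hS c y).trans (setLIntegral_le_lintegral _ _)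
  _ = _ := by
    rw [lintegral_const_mul' _ _ (by finiteness), lintegral_finsetSum _ fun x _ =>
      measurable_const.indicator Metric.isClosed_closedBall.measurableSet]
    simp only [lintegral_indicator_const Metric.isClosed_closedBall.measurableSet,
      Measure.addHaar_closedBall_center]
    rw [← Finset.sum_mul]
    ring

end Stability

end AffineMesh

theorem coeFn_sum_smul_toLp {ι X F : Type*} [Fintype ι] [MeasurableSpace X] {μ : Measure X}
    [NormedAddCommGroup F] [NormedSpace ℝ F] {p : ℝ≥0∞} {f : ι → X → F}
    (hf : ∀ i, MemLp (f i) p μ) (c : ι → ℝ) :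
    ⇑(∑ i, c i • (hf i).toLp) =ᵐ[μ] fun x => ∑ i, c i • f i x := by
  have hcoe (i) : ⇑(c i • (hf i).toLp) =ᵐ[μ] c i • f i :=
    (Lp.coeFn_smul _ _).trans ((hf i).coeFn_toLp.const_smul (c i))
  filter_upwards [Lp.coeFn_fun_finsetSum Finset.univ fun i => c i • (hf i).toLp,
    eventually_all.2 hcoe] with x hsum hx
  rw [hsum]
  exact Finset.sum_congr rfl fun i _ => hx i

namespace AffineMesh

section Defect

variable {d : ℕ} {K Ω : Set (Pt d)} (T : AffineMesh K Ω) (RV RQ : LagrangeElement K)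

theorem dirFun_eq_feFn (U : T.DirDof RV → ℝ) :
    T.dirFun RV U = T.feFn RV fun x => WithLp.toLp 2 fun c => U (x, c) := by
  ext y c
  simp [dirFun, feFn, dirBasis, Fintype.sum_prod_type, mul_comm, Pi.single_apply]

variable {n : Pt d → Dir}

open Classical in
theorem defectMatrix_eq_smul_residualGram
    (hφ : ∀ k, MemLp (fun y => inner ℝ (n y) (T.dirBasis RV k y)) 2 (volume.restrict Ω))
    (hχ : ∀ j, MemLp (T.mulBasis RQ j) 2 (volume.restrict Ω)) :
    T.defectMatrix RV RQ n =
      (4 : ℝ) • residualGram (fun j => (hχ j).toLp) (fun k => (hφ k).toLp) := by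
  have inner_toLp {f g : Pt d → ℝ} (hf : MemLp f 2 (volume.restrict Ω))
      (hg : MemLp g 2 (volume.restrict Ω)) : inner ℝ hf.toLp hg.toLp = ∫ y in Ω, f y * g y := by
    rw [L2.inner_def]
    refine integral_congr_ae ?_
    filter_upwards [hf.coeFn_toLp, hg.coeFn_toLp] with y hfy hgy
    rw [hfy, hgy]
    simp [mul_comm]
  have haug : T.augMatrix RV n = (4 : ℝ) • Matrix.gram ℝ fun k => (hφ k).toLp := by
    ext k l
    simp [augMatrix, inner_toLp, mul_comm]
  have hmass : T.massMatrix RQ = Matrix.gram ℝ fun j => (hχ j).toLp := by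
    ext i j
    simp [massMatrix, inner_toLp]
  have hconstr : T.constraintMatrix RV RQ n =
      (2 : ℝ) • Matrix.of fun j k => inner ℝ (hχ j).toLp (hφ k).toLp := by
    ext j k
    simp [constraintMatrix, inner_toLp, mul_left_comm _ (2 : ℝ), integral_const_mul]
  rw [defectMatrix, haug, hmass, hconstr, residualGram, smul_sub, Matrix.transpose_smul,
    Matrix.smul_mul, Matrix.smul_mul, Matrix.mul_smul, smul_smul]
  norm_num

theorem inner_dirFun (n : Pt d → Dir) (U : T.DirDof RV → ℝ) (y : Pt d) :
    inner ℝ (n y) (T.dirFun RV U y) = ∑ k, U k • inner ℝ (n y) (T.dirBasis RV k y) := by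
  simp [dirFun, inner_sum, inner_smul_right]

theorem lintegral_enorm_inner_dirFun_sq_le (hK : IsCompact K) {b S : ℝ≥0}
    (hS : ∀ y ∈ K, ∑ a, |RV.shapeFn a y| ≤ S) (hb : ∀ᵐ y ∂volume.restrict Ω, ‖n y‖ ≤ b)
    (U : T.DirDof RV → ℝ) :
    ∫⁻ y in Ω, ‖inner ℝ (n y) (T.dirFun RV U y)‖ₑ ^ 2 ≤
      b ^ 2 * S ^ 2 * volume (Metric.closedBall (0 : Pt d) T.size) *
        ‖WithLp.toLp 2 U‖ₑ ^ 2 := by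
  have hnorm : ∑ x, ‖WithLp.toLp 2 fun c : Fin 3 => U (x, c)‖ₑ ^ 2 = ‖WithLp.toLp 2 U‖ₑ ^ 2 := by
    have : ∑ x, ‖WithLp.toLp 2 fun c : Fin 3 => U (x, c)‖₊ ^ 2 = ‖WithLp.toLp 2 U‖₊ ^ 2 := by
      ext
      simp [EuclideanSpace.norm_sq_eq, Fintype.sum_prod_type]
    simp only [enorm_eq_nnnorm]
    exact_mod_cast this
  calc ∫⁻ y in Ω, ‖inner ℝ (n y) (T.dirFun RV U y)‖ₑ ^ 2
      ≤ ∫⁻ y in Ω, b ^ 2 * ‖T.dirFun RV U y‖ₑ ^ 2 := by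
        refine lintegral_mono_ae (hb.mono fun y hy => ?_)
        rw [← mul_pow]
        gcongr
        rw [← ofReal_norm, ← ofReal_norm, ← ENNReal.ofReal_coe_nnreal,
          ← ENNReal.ofReal_mul NNReal.zero_le_coe]
        exact ENNReal.ofReal_le_ofReal ((norm_inner_le_norm _ _).trans (by gcongr))
    _ ≤ b ^ 2 * (S ^ 2 * volume (Metric.closedBall (0 : Pt d) T.size) *
          ‖WithLp.toLp 2 U‖ₑ ^ 2) := by
        rw [lintegral_const_mul' _ _ (by finiteness), dirFun_eq_feFn, ← hnorm]
        gcongr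
        exact T.lintegral_enorm_feFn_sq_le hK hS _
    _ = _ := by ring

variable (hK : IsCompact K) (hKconv : Convex ℝ K) (hKi : (interior K).Nonempty)
  (hreg : interior (closure Ω) = Ω)

include hK hKconv hKi hreg

theorem linearIndependent_toLp_mulBasis :
    LinearIndependent ℝ fun j : T.MulDof RQ =>
      (T.memLp_basisFn RQ hK hKconv hKi hreg j (p := 2)).toLp := by
  refine Fintype.linearIndependent_iff.2 fun c hc => congrFun ?_
  refine T.eq_zero_of_feFn_ae_eq_zero RQ hKconv hKi hreg ?_
  have hsum := coeFn_sum_smul_toLp (fun j : T.MulDof RQ =>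
    T.memLp_basisFn RQ hK hKconv hKi hreg j (p := 2)) c
  rw [hc] at hsum
  filter_upwards [hsum, Lp.coeFn_zero ℝ 2 (volume.restrict Ω)] with y hy h0
  rw [h0] at hy
  simpa only [feFn, smul_eq_mul, mul_comm] using hy.symm

theorem memLp_inner_dirBasis (hn : AEStronglyMeasurable n (volume.restrict Ω)) {b : ℝ≥0}
    (hb : ∀ᵐ y ∂volume.restrict Ω, ‖n y‖ ≤ b) (k : T.DirDof RV) :
    MemLp (fun y => inner ℝ (n y) (T.dirBasis RV k y)) 2 (volume.restrict Ω) := by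
  have hbasis := T.memLp_basisFn RV hK hKconv hKi hreg k.1 (p := 2)
  have hsmul : T.dirBasis RV k = fun y => T.basisFn RV k.1 y • EuclideanSpace.single k.2 1 := by
    ext y c
    simp [dirBasis]
  refine hbasis.of_le_mul (c := b) (hn.inner ?_) (hb.mono fun y hy => ?_)
  · rw [hsmul]
    exact hbasis.aestronglyMeasurable.smul_const _
  · refine (norm_inner_le_norm _ _).trans ?_
    rw [dirBasis, PiLp.norm_single]
    gcongr

theorem enorm_defectMatrix_mulVec_sq_le {b S : ℝ≥0}
    (hS : ∀ y ∈ K, ∑ a, |RV.shapeFn a y| ≤ S) (hn : AEStronglyMeasurable n (volume.restrict Ω))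
    (hb : ∀ᵐ y ∂volume.restrict Ω, ‖n y‖ ≤ b) (U : T.DirDof RV → ℝ) (q : T.nodes RQ → ℝ) :
    ‖WithLp.toLp 2 (T.defectMatrix RV RQ n *ᵥ U)‖ₑ ^ 2 ≤
      16 * b ^ 2 * S ^ 2 * volume (Metric.closedBall (0 : Pt d) T.size) *
        ∫⁻ y in Ω, ‖inner ℝ (n y) (T.dirFun RV U y) - T.feFn RQ q y‖ₑ ^ 2 := by
  obtain ⟨V, hV⟩ : ∃ V : ℝ≥0, V = volume (Metric.closedBall (0 : Pt d) T.size) :=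
    ⟨_, ENNReal.coe_toNNReal (isCompact_closedBall _ _).measure_ne_top⟩
  have hφ := T.memLp_inner_dirBasis RV hK hKconv hKi hreg hn hb
  have hχ (j : T.MulDof RQ) := T.memLp_basisFn RQ hK hKconv hKi hreg j (p := 2)
  have hsum (w : T.DirDof RV → ℝ) : ⇑(∑ k, w k • (hφ k).toLp) =ᵐ[volume.restrict Ω]
      fun y => inner ℝ (n y) (T.dirFun RV w y) :=
    (coeFn_sum_smul_toLp hφ w).trans (ae_of_all _ fun y => (T.inner_dirFun RV n w y).symm)
  have hψ (w : T.DirDof RV → ℝ) : ‖∑ k, w k • (hφ k).toLp‖₊ ^ 2 ≤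
      b ^ 2 * S ^ 2 * V * ‖WithLp.toLp 2 w‖₊ ^ 2 := by
    have h := T.lintegral_enorm_inner_dirFun_sq_le RV hK hS hb w
    rw [← eLpNorm_two_sq, ← eLpNorm_congr_ae (hsum w), ← Lp.enorm_def, enorm_eq_nnnorm,
      enorm_eq_nnnorm, ← hV] at h
    exact_mod_cast h
  have hq : ∑ j, q j • (hχ j).toLp ∈ Submodule.span ℝ (Set.range fun j => (hχ j).toLp) :=
    Submodule.sum_smul_mem _ _ fun j _ => Submodule.subset_span (Set.mem_range_self j)
  have hdiff : ⇑(∑ k, U k • (hφ k).toLp - ∑ j, q j • (hχ j).toLp) =ᵐ[volume.restrict Ω]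
      fun y => inner ℝ (n y) (T.dirFun RV U y) - T.feFn RQ q y := by
    filter_upwards [Lp.coeFn_sub (∑ k, U k • (hφ k).toLp) (∑ j, q j • (hχ j).toLp), hsum U,
      coeFn_sum_smul_toLp hχ q] with y hy hU hq
    rw [hy, Pi.sub_apply, hU, hq]
    simp only [feFn, smul_eq_mul, mul_comm]
  have h := nnnorm_residualGram_mulVec_sq_le
    (T.linearIndependent_toLp_mulBasis RQ hK hKconv hKi hreg) hψ U hq
  rw [← eLpNorm_two_sq, ← eLpNorm_congr_ae hdiff, ← Lp.enorm_def,
    T.defectMatrix_eq_smul_residualGram RV RQ hφ hχ, Matrix.smul_mulVec, WithLp.toLp_smul,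
    enorm_smul, enorm_eq_nnnorm, enorm_eq_nnnorm, enorm_eq_nnnorm, ← hV]
  have h4 : ‖(4 : ℝ)‖₊ = 4 := by simp
  rw [h4]
  norm_cast
  rw [mul_pow]
  calc _ ≤ 4 ^ 2 * _ := mul_le_mul_right h _
    _ = _ := by ring

end Defect

end AffineMesh

theorem AffineMesh.size_pos_of_dirDof {d : ℕ} {K Ω : Set (Pt d)} (T : AffineMesh K Ω)
    {R : LagrangeElement K} (hd : 0 < d) (hK : IsCompact K) (hKi : (interior K).Nonempty)
    (k : T.DirDof R) : 0 < T.size := by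
  classical
  obtain ⟨⟨i, _⟩, -, -⟩ := Finset.mem_image.1 (Finset.mem_filter.1 k.1.2).1
  exact T.size_pos hd hK hKi i

section Estimate

variable {d : ℕ} {K : Set (Pt d)} (hK : IsCompact K) (hKconv : Convex ℝ K)
  (hKi : (interior K).Nonempty) (RV RQ : LagrangeElement K)

include hK hKconv hKi

theorem exists_enorm_defectMatrix_mulVec_sq_le (b L : ℝ≥0) :
    ∃ C : ℝ≥0, ∀ Ω : Set (Pt d), interior (closure Ω) = Ω →
      ∀ (n : Pt d → Dir) (Gn : Pt d → EuclideanSpace ℝ (Fin 3 × Fin d)), IsWeakGradient Ω n Gn →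
      (∀ᵐ x ∂volume.restrict Ω, ‖n x‖ ≤ b) → (∀ᵐ x ∂volume.restrict Ω, ‖Gn x‖ ≤ L) →
      ∀ T : AffineMesh K Ω, T.IsConforming RV → ∀ (U : T.DirDof RV → ℝ)
        (G : Pt d → EuclideanSpace ℝ (Fin 3 × Fin d)), IsWeakGradient Ω (T.dirFun RV U) G →
        ‖WithLp.toLp 2 (T.defectMatrix RV RQ n *ᵥ U)‖ₑ ^ 2 ≤
          C * ENNReal.ofReal T.size ^ (d + 2) *
            ((∫⁻ y in Ω, ‖T.dirFun RV U y‖ₑ ^ 2) + ∫⁻ y in Ω, ‖G y‖ₑ ^ 2) := by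
  obtain ⟨S, hS⟩ := RV.exists_sum_abs_shapeFn_le hK
  obtain ⟨C, hC⟩ := AffineMesh.exists_lintegral_inner_sub_interpolant_sq_le (F := Dir) RV RQ
    hK hKconv hKi b L
  refine ⟨16 * b ^ 2 * S ^ 2 * (volume (Metric.ball (0 : Pt d) 1)).toNNReal * C,
    fun Ω hreg n Gn hn hb hGn T hT U G hG => ?_⟩
  have hΩ : IsOpen Ω := hreg ▸ isOpen_interior
  have := T.isFiniteMeasure_restrict hK
  have hnmeas : AEStronglyMeasurable n (volume.restrict Ω) :=
    hn.locallyIntegrable.aestronglyMeasurable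
  obtain ⟨m, hnm, hm⟩ := hn.hasWeakFDeriv.exists_lipschitz_representative hΩ
    (Integrable.of_bound hnmeas b hb) L.2 (hGn.mono fun x hx => (norm_gradMap_le _).trans hx)
  set c : T.interiorNodes RV → Dir := fun x => WithLp.toLp 2 fun k => U (x, k)
  have hUc : T.dirFun RV U = T.feFn RV c := T.dirFun_eq_feFn RV U
  set q : T.nodes RQ → ℝ := fun x => inner ℝ (m x) (T.feFn RV c x)
  have hmb : ∀ᵐ y ∂volume.restrict Ω, ‖m y‖ ≤ b := by
    filter_upwards [hb, hnm] with y hy hny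
    exact hny ▸ hy
  have hres : ∫⁻ y in Ω, ‖inner ℝ (n y) (T.dirFun RV U y) - T.feFn RQ q y‖ₑ ^ 2 ≤
      C * ENNReal.ofReal T.size ^ 2 *
        ((∫⁻ y in Ω, ‖T.dirFun RV U y‖ₑ ^ 2) + ∫⁻ y in Ω, ‖G y‖ₑ ^ 2) := by
    rw [hUc]
    rw [hUc] at hG
    rw [lintegral_congr_ae (g := fun y => ‖inner ℝ (m y) (T.feFn RV c y) - T.feFn RQ q y‖ₑ ^ 2)
      (hnm.mono fun y hy => by simp only [hy])]
    refine (hC Ω T hreg hT m hmb hm c _ hG.hasWeakFDeriv hG.locallyIntegrable_gradMap).trans ?_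
    gcongr with y
    exact enorm_le_iff_norm_le.2 (norm_gradMap_le _)
  calc _ ≤ _ := T.enorm_defectMatrix_mulVec_sq_le RV RQ hK hKconv hKi hreg hS hnmeas hb U q
    _ ≤ _ := mul_le_mul_right hres _
    _ = _ := by
      rw [Measure.addHaar_closedBall _ _ T.size_nonneg, finrank_euclideanSpace_fin,
        ENNReal.ofReal_pow T.size_nonneg]
      push_cast
      rw [ENNReal.coe_toNNReal Metric.isBounded_ball.measure_lt_top.ne]
      ring

theorem exists_norm_defectMatrix_mulVec_le (hd : 0 < d) (β L : ℝ) :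
    ∃ C : ℝ, 0 < C ∧ ∀ Ω : Set (Pt d), interior (closure Ω) = Ω →
      ∀ (n : Pt d → Dir) (Gn : Pt d → EuclideanSpace ℝ (Fin 3 × Fin d)), IsWeakGradient Ω n Gn →
      (∀ᵐ x ∂volume.restrict Ω, ‖n x‖ ^ 2 ≤ β) → (∀ᵐ x ∂volume.restrict Ω, ‖Gn x‖ ≤ L) →
      ∀ T : AffineMesh K Ω, T.IsConforming RV → ∀ U : T.DirDof RV → ℝ,
        ENNReal.ofReal ‖WithLp.toLp 2 (T.defectMatrix RV RQ n *ᵥ U)‖ ≤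
          ENNReal.ofReal (C * T.size ^ (1 + (d : ℝ) / 2)) * h1Norm Ω (T.dirFun RV U) := by
  obtain ⟨C, hC⟩ := exists_enorm_defectMatrix_mulVec_sq_le hK hKconv hKi RV RQ
    (√β).toNNReal L.toNNReal
  refine ⟨√(C + 1), by positivity, fun Ω hreg n Gn hn hnβ hGn T hT U => ?_⟩
  rcases isEmpty_or_nonempty (T.DirDof RV) with hempty | ⟨⟨k⟩⟩
  · rw [Subsingleton.elim (WithLp.toLp 2 (T.defectMatrix RV RQ n *ᵥ U)) 0, norm_zero,
      ENNReal.ofReal_zero]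
    exact zero_le
  have hsize : 0 < T.size := T.size_pos_of_dirDof hd hK hKi k
  set a : ℝ := √(C + 1) * T.size ^ (1 + (d : ℝ) / 2)
  have ha : 0 < a := by positivity
  have ha_sq : a ^ 2 = (C + 1) * T.size ^ (d + 2) := by
    rw [mul_pow, Real.sq_sqrt (by positivity), ← Real.rpow_mul_natCast hsize.le,
      ← Real.rpow_natCast T.size]
    congr 2
    push_cast
    ring
  simp only [h1Norm, ENNReal.mul_iInf_of_ne (ENNReal.ofReal_pos.2 ha).ne' ENNReal.ofReal_ne_top]
  refine le_iInf₂ fun G hG => (ENNReal.pow_le_pow_left_iff two_ne_zero).1 ?_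
  have hest := hC Ω hreg n Gn hn
    (hnβ.mono fun x hx => (Real.le_sqrt_of_sq_le hx).trans (Real.le_coe_toNNReal _))
    (hGn.mono fun x hx => hx.trans (Real.le_coe_toNNReal _)) T hT U G hG
  have hroot (H : ℝ≥0∞) : (H ^ (1 / 2 : ℝ)) ^ 2 = H := by
    rw [← ENNReal.rpow_mul_natCast]
    norm_num
  rw [ofReal_norm, mul_pow, hroot, ← ENNReal.ofReal_pow ha.le, ha_sq,
    ENNReal.ofReal_mul (by positivity), ENNReal.ofReal_pow hsize.le]
  refine hest.trans ?_
  gcongr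
  exact ENNReal.ofReal_coe_nnreal.symm.trans_le (ENNReal.ofReal_le_ofReal (by linarith))

end Estimate

end OseenFrank

end

theorem theorem3p1_general {d : ℕ} (hd : 0 < d) {K : Set (OseenFrank.Pt d)} (hK : IsCompact K)
    (hKconv : Convex ℝ K) (hKi : (interior K).Nonempty) (RV RQ : OseenFrank.LagrangeElement K)
    (β L : ℝ) :
    ∃ C : ℝ, 0 < C ∧ ∀ Ω : Set (OseenFrank.Pt d), interior (closure Ω) = Ω →
      ∀ (n : OseenFrank.Pt d → OseenFrank.Dir)
        (Gn : OseenFrank.Pt d → EuclideanSpace ℝ (Fin 3 × Fin d)),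
        OseenFrank.IsWeakGradient Ω n Gn →
        (∀ᵐ x ∂volume.restrict Ω, ‖n x‖ ^ 2 ≤ β) → (∀ᵐ x ∂volume.restrict Ω, ‖Gn x‖ ≤ L) →
        (∀ T : OseenFrank.AffineMesh K Ω, T.IsConforming RV → ∀ U : T.DirDof RV → ℝ,
          ENNReal.ofReal ‖WithLp.toLp 2 (T.defectMatrix RV RQ n *ᵥ U)‖ ≤
            ENNReal.ofReal (C * T.size ^ (1 + (d : ℝ) / 2)) *
              OseenFrank.h1Norm Ω (T.dirFun RV U)) ∧
        (∀ T : ℕ → OseenFrank.AffineMesh K Ω, (∀ j, (T j).IsConforming RV) →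
          Tendsto (fun j => (T j).size) atTop (𝓝 0) →
          ∀ U : (j : ℕ) → (T j).DirDof RV → ℝ,
          (∃ M : ℝ≥0, ∀ j, OseenFrank.h1Norm Ω ((T j).dirFun RV (U j)) ≤ M) →
          Tendsto (fun j => ‖WithLp.toLp 2 ((T j).defectMatrix RV RQ n *ᵥ U j)‖)
            atTop (𝓝 0)) := by
  obtain ⟨C, hC, hmain⟩ :=
    OseenFrank.exists_norm_defectMatrix_mulVec_le hK hKconv hKi RV RQ hd β L
  refine ⟨C, hC, fun Ω hreg n Gn hn hnβ hGn => ?_⟩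
  have hest := hmain Ω hreg n Gn hn hnβ hGn
  refine ⟨hest, fun T hT hsize U ⟨M, hM⟩ => ?_⟩
  have hlim : Tendsto (fun j => C * (T j).size ^ (1 + (d : ℝ) / 2) * M) atTop (𝓝 0) := by
    have hpos : 0 < 1 + (d : ℝ) / 2 := by positivity
    simpa [Real.zero_rpow hpos.ne'] using
      ((hsize.rpow_const (Or.inr hpos.le)).const_mul C).mul_const (M : ℝ)
  refine squeeze_zero (fun j => norm_nonneg _) (fun j => ?_) hlim
  have hj := (hest (T j) (hT j) (U j)).trans (mul_le_mul_right (hM j) _)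
  have hs := (T j).size_nonneg
  rwa [← ENNReal.ofReal_coe_nnreal, ← ENNReal.ofReal_mul (by positivity),
    ENNReal.ofReal_le_ofReal_iff (by positivity)] at hj

theorem theorem3p1 {d : ℕ} (hd : d = 2 ∨ d = 3)
    -- reference cell, director element and multiplier element
    (K : Set (OseenFrank.Pt d)) (hKc : IsCompact K) (hKconv : Convex ℝ K)
    (hKi : (interior K).Nonempty)
    (RV RQ : OseenFrank.LagrangeElement K)
    -- bounds for the current approximation of the director
    (α β L : ℝ) (hα : 0 < α) (hα1 : α ≤ 1) (hβ : 1 ≤ β) :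
    ∃ C : ℝ, 0 < C ∧
      ∀ Ω : Set (OseenFrank.Pt d), IsOpen Ω → Bornology.IsBounded Ω → interior (closure Ω) = Ω →
      ∀ (n : OseenFrank.Pt d → OseenFrank.Dir)
        (Gn : OseenFrank.Pt d → EuclideanSpace ℝ (Fin 3 × Fin d)),
        OseenFrank.IsWeakGradient Ω n Gn →
        (∀ᵐ x ∂(volume.restrict Ω), α ≤ ‖n x‖ ^ 2 ∧ ‖n x‖ ^ 2 ≤ β) →
        (∀ᵐ x ∂(volume.restrict Ω), ‖Gn x‖ ≤ L) →
        -- the estimate, with `C` independent of the mesh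
        (∀ T : OseenFrank.AffineMesh K Ω, T.IsConforming RV → ∀ U : T.DirDof RV → ℝ,
          ENNReal.ofReal ‖WithLp.toLp 2 (T.defectMatrix RV RQ n *ᵥ U)‖ ≤
            ENNReal.ofReal (C * T.size ^ (1 + (d : ℝ) / 2)) *
              OseenFrank.h1Norm Ω (T.dirFun RV U)) ∧
        -- the difference vanishes as the mesh size tends to zero
        (∀ T : ℕ → OseenFrank.AffineMesh K Ω, (∀ j, (T j).IsConforming RV) →
          Tendsto (fun j => (T j).size) atTop (𝓝 0) →
          ∀ U : (j : ℕ) → (T j).DirDof RV → ℝ,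
          (∃ M : ℝ≥0, ∀ j, OseenFrank.h1Norm Ω ((T j).dirFun RV (U j)) ≤ M) →
          Tendsto (fun j => ‖WithLp.toLp 2 ((T j).defectMatrix RV RQ n *ᵥ U j)‖)
            atTop (𝓝 0)) := by
  obtain ⟨C, hC, hmain⟩ := theorem3p1_general (by omega) hKc hKconv hKi RV RQ β L
  exact ⟨C, hC, fun Ω _ _ hreg n Gn hn hnb hGn =>
    hmain Ω hreg n Gn hn (hnb.mono fun _ hx => hx.2) hGn⟩
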